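/- \textbf{Theorem.} Let $\mathbb F=\mathbb R$ or $\mathbb C$ and let $1<p<\infty$. There is a reflexive Banach space $X$ over $\mathbb F$ with a Schauder basis $\mathcal X=(x_n)_{n=1}^\infty$, with coordinate functionals $(x_n^*)_{n=1}^\infty$ and coordinate projections $S_A(x)=\sum_{n\in A}x_n^*(x)\,x_n$, such that: (a) $\mathcal X$ is conditional, i.e. not unconditional; (b) $\mathcal X$ is bimonotone, i.e. $\|S_I\|\le 1$ for every interval $I\subset\mathbb N$ of integers; (c) $\mathcal X$ is isometrically bidemocratic, i.e. $\varphi_m\,\varphi_m^*\le m$ for all $m\in\mathbb N$, where $\varphi_m=\sup\|\sum_{n\in A}\varepsilon_n x_n\|$ and $\varphi_m^*=\sup\|\sum_{n\in A}\varepsilon_n x^*_n\|$, the suprema being taken over all $A\subset\mathbb N$ with $|A|\le m$ and all scalars $\varepsilon_n$ with $|\varepsilon_n|=1$; (d) $\mathcal X$ is $1$-suppression quasi-greedy, i.e. $\|x-S_A(x)\|\le\|x\|$ whenever $x\in X$ and $A\subset\mathbb N$ is a finite set with $|x_n^*(x)|\ge|x_k^*(x)|$ for all $n\in A$, $k\notin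 A$; (e) $k_m\approx\widetilde k_m\approx\log(1+m)$ for $m\in\mathbb N=\{1,2,\dots\}$, where $k_m=\sup_{|A|\le m}\|S_A\|$, $\widetilde k_m=\sup\{\|S_A(x)\|: A\subset\mathbb N,\ \|x\|\le1,\ x_n^*(x)=0\text{ for }n>m\}$, and $\alpha_m\approx\beta_m$ means that there is a constant $C$ with $\alpha_m\le C\beta_m$ and $\beta_m\le C\alpha_m$ for all $m\in\mathbb N$. Moreover, $X$ can be taken to be the $\ell_p$-sum $\bigl(\bigoplus_{k=1}^\infty Y_k\bigr)_{\ell_p}$, with $\mathcal X$ the natural arrangement of the unit vectors of the summands, where $Y_k$ is $\mathbb F^{2^{k-1}}$ (identified with the sequences $f=(a_n)_{n=1}^\infty$ such that $a_n=0$ for $n>2^{k-1}$) with the norm \[ \|f\|=\sup_{B}\Bigl(|B|^{1/p-1}\sum_{n\in B}|a_n|+\sup_{I}\Bigl|\sum_{n\in I\setminus B}a_n\,\frac{n^{1/p}-(n-1)^{1/p}}2\Bigr|\Bigr), \] $B$ running over the finite subsets of $\mathbb N$ and $I$ over the finite intervals of integers that are empty or satisfy $\min I>|B|$ (for $B=\emptyset$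 the first summand is $0$). -/

import Mathlib

open scoped ENNReal NNReal

universe u

noncomputable section

/-- A normed space is reflexive if the canonical embedding into its bidual is onto. -/
def IsReflexiveSpace (𝕜 : Type*) [RCLike 𝕜] (X : Type*) [NormedAddCommGroup X]
    [NormedSpace 𝕜 X] : Prop :=
  Function.Surjective (NormedSpace.inclusionInDoubleDual 𝕜 X)

namespace SchauderBasis

section
variable {𝕜 : Type*} [RCLike 𝕜] {X : Type*} [NormedAddCommGroup X] [NormedSpace 𝕜 X]

/-- The coordinate projection `S_A` for a finite set `A` of indices. -/
def coordProj (b : SchauderBasis 𝕜 X) (A : Finset ℕ) : X →L[𝕜] X :=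
  GeneralSchauderBasis.proj b A

/-- A basis is unconditional if all its expansions converge unconditionally. -/
def IsUnconditional (b : SchauderBasis 𝕜 X) : Prop :=
  ∀ x : X, Summable (fun n => b.coord n x • b n)

/-- A basis is conditional if it is not unconditional. -/
def IsConditional (b : SchauderBasis 𝕜 X) : Prop := ¬ IsUnconditional b

/-- A basis is bimonotone if `‖S_I‖ ≤ 1` for every interval `I` of indices, bounded or not. -/
def IsBimonotone (b : SchauderBasis 𝕜 X) : Prop :=
  (∀ m n : ℕ, ‖coordProj b (Finset.Ico m n)‖ ≤ 1) ∧
    ∀ m : ℕ, ‖ContinuousLinearMap.id 𝕜 X - coordProj b (Finset.range m)‖ ≤ 1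

end

/-- The fundamental function `φ_m` of a sequence `v` in a normed space: the supremum of
`‖∑_{n ∈ A} ε_n v_n‖` over all finite sets `A` with at most `m` elements and all choices of
scalars `ε_n` of modulus one. -/
def fundFun (𝕜 : Type*) [RCLike 𝕜] {E : Type*} [NormedAddCommGroup E] [NormedSpace 𝕜 E]
    (v : ℕ → E) (m : ℕ) : ℝ≥0∞ :=
  ⨆ (A : Finset ℕ) (_ : A.card ≤ m) (ε : ℕ → 𝕜) (_ : ∀ n, ‖ε n‖ = 1), ‖∑ n ∈ A, ε n • v n‖ₑ

section
variable {𝕜 : Type*} [RCLike 𝕜] {X : Type*} [NormedAddCommGroup X] [NormedSpace 𝕜 X]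

/-- A basis is isometrically bidemocratic if the fundamental functions of the basis and of
the sequence of its coordinate functionals satisfy `φ_m φ_m^* ≤ m`. -/
def IsIsometricallyBidemocratic (b : SchauderBasis 𝕜 X) : Prop :=
  ∀ m : ℕ, 1 ≤ m → fundFun 𝕜 (fun n => b n) m * fundFun 𝕜 (fun n => b.coord n) m ≤ (m : ℝ≥0∞)

/-- A finite set `A` is a greedy set of `x` if the coefficients of `x` on `A` are, in modulus,
at least as large as those off `A`; `S_A x` is then an `m`-term greedy approximation of `x`
with `m = |A|`. -/
def IsGreedySet (b : SchauderBasis 𝕜 X) (x : X) (A : Finset ℕ) : Prop :=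
  ∀ n ∈ A, ∀ k ∉ A, ‖b.coord k x‖ ≤ ‖b.coord n x‖

/-- `1`-suppression quasi-greedy: removing a greedy approximation does not increase the norm. -/
def IsOneSuppressionQuasiGreedy (b : SchauderBasis 𝕜 X) : Prop :=
  ∀ (x : X) (A : Finset ℕ), IsGreedySet b x A → ‖x - coordProj b A x‖ ≤ ‖x‖

/-- The unconditionality parameter `k_m`. -/
def uncondParam (b : SchauderBasis 𝕜 X) (m : ℕ) : ℝ≥0∞ :=
  ⨆ (A : Finset ℕ) (_ : A.card ≤ m), ‖coordProj b A‖ₑ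

/-- The unconditionality parameter `k̃_m`. The vectors `x` are supported on the first `m`
indices, so that finite sets `A` give the same supremum as arbitrary ones. -/
def uncondParamTilde (b : SchauderBasis 𝕜 X) (m : ℕ) : ℝ≥0∞ :=
  ⨆ (A : Finset ℕ) (x : X) (_ : ‖x‖ ≤ 1) (_ : ∀ n, m ≤ n → b.coord n x = 0), ‖coordProj b A x‖ₑ

end

end SchauderBasis

/-- Equivalence `α_m ≈ β_m` for `m ∈ {1, 2, …}`. -/
def SeqEquiv (α β : ℕ → ℝ≥0∞) : Prop :=
  ∃ C : ℝ≥0, (∀ m, 1 ≤ m → α m ≤ C * β m) ∧ (∀ m, 1 ≤ m → β m ≤ C * α m)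

/-- The norm
`sup_B (|B|^(1/p-1) ∑_{n ∈ B} |a_n| + sup_{I > |B|} |∑_{n ∈ I \ B} a_n (n^(1/p) - (n-1)^(1/p)) / 2|)`
where `B` runs over the finite sets of positive integers and `I` over the finite intervals of
positive integers larger than `|B|`. Here sequences are indexed from `0`: the entry `f n` is
`a_(n+1)`. -/
def truncNorm {𝕜 : Type*} [RCLike 𝕜] (p : ℝ) (f : ℕ → 𝕜) : ℝ≥0∞ :=
  ⨆ (B : Finset ℕ) (k : ℕ) (l : ℕ) (_ : B.card ≤ k),
    ENNReal.ofReal ((B.card : ℝ) ^ (1 / p - 1) * ∑ n ∈ B, ‖f n‖ +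
      ‖∑ n ∈ Finset.Ico k l \ B,
        f n * (((((n : ℝ) + 1) ^ (1 / p) - (n : ℝ) ^ (1 / p)) / 2 : ℝ) : 𝕜)‖)

/-- The indices are split into consecutive blocks of lengths `1, 2, 4, 8, …`; the block of length
`2 ^ k` starts at the index `2 ^ k - 1` (counting from `0`). This is the `k`-th block of `a`, as a
sequence supported on the first `2 ^ k` indices. -/
def dyadicBlock {𝕜 : Type*} [RCLike 𝕜] (a : ℕ → 𝕜) (k : ℕ) : ℕ → 𝕜 :=
  fun j => if j < 2 ^ k then a (2 ^ k - 1 + j) else 0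

/-- The norm of the `ℓ_p`-sum of the spaces `𝕜 ^ (2 ^ k)` with the norm `truncNorm p`, in the
natural arrangement of the coordinates. -/
def blockSumNorm {𝕜 : Type*} [RCLike 𝕜] (p : ℝ) (a : ℕ → 𝕜) : ℝ≥0∞ :=
  (∑' k : ℕ, truncNorm p (dyadicBlock a k) ^ p) ^ (1 / p)

end

/-- Half the increment of `x ↦ x ^ s` on `[n, n + 1]`. -/
noncomputable def rpowIncr (s : ℝ) (n : ℕ) : ℝ := (((n : ℝ) + 1) ^ s - (n : ℝ) ^ s) / 2

section RpowIncr

variable {s : ℝ}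

theorem mul_rpow_sub_one_le_rpow_sub (h0 : 0 ≤ s) (h1 : s ≤ 1) {x : ℝ} (hx : 0 ≤ x) :
    s * (x + 1) ^ (s - 1) ≤ (x + 1) ^ s - x ^ s := by
  have hx1 : 0 < x + 1 := by linarith
  have hle : (-1 : ℝ) ≤ -(1 / (x + 1)) := by
    rw [neg_le_neg_iff, div_le_one hx1]; linarith
  have hB := rpow_one_add_le_one_add_mul_self hle h0 h1
  have he : 1 + -(1 / (x + 1)) = x / (x + 1) := by field_simp; ring
  rw [he, Real.div_rpow hx hx1.le, div_le_iff₀ (Real.rpow_pos_of_pos hx1 s)] at hB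
  have hp : (x + 1) ^ s = (x + 1) ^ (s - 1) * (x + 1) := by
    rw [Real.rpow_sub_one hx1.ne']; field_simp
  have : s * -(1 / (x + 1)) * (x + 1) ^ s = - (s * (x + 1) ^ (s - 1)) := by
    rw [hp]; field_simp
  linarith [add_mul 1 (s * -(1 / (x + 1))) ((x + 1) ^ s)]

theorem rpow_sub_le_mul_rpow_sub_one (h0 : 0 ≤ s) (h1 : s ≤ 1) {x : ℝ} (hx : 0 < x) :
    (x + 1) ^ s - x ^ s ≤ s * x ^ (s - 1) := by
  have hle : (-1 : ℝ) ≤ 1 / x := by have : 0 < 1 / x := by positivity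
                                    linarith
  have hB := rpow_one_add_le_one_add_mul_self hle h0 h1
  have he : 1 + 1 / x = (x + 1) / x := by field_simp
  rw [he, Real.div_rpow (by linarith) hx.le, div_le_iff₀ (Real.rpow_pos_of_pos hx s)] at hB
  have hp : x ^ s = x ^ (s - 1) * x := by
    rw [Real.rpow_sub_one hx.ne']; field_simp
  have : s * (1 / x) * x ^ s = s * x ^ (s - 1) := by
    rw [hp]; field_simp
  linarith [add_mul 1 (s * (1 / x)) (x ^ s)]

theorem rpowIncr_nonneg (h0 : 0 ≤ s) (n : ℕ) : 0 ≤ rpowIncr s n := by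
  have : (n : ℝ) ^ s ≤ ((n : ℝ) + 1) ^ s :=
    Real.rpow_le_rpow (by positivity) (by linarith) h0
  unfold rpowIncr
  linarith

theorem antitone_rpowIncr (h0 : 0 ≤ s) (h1 : s ≤ 1) : Antitone (rpowIncr s) := by
  refine antitone_nat_of_succ_le fun n => ?_
  have h := mul_rpow_sub_one_le_rpow_sub h0 h1 (x := n) (by positivity)
  have h' := rpow_sub_le_mul_rpow_sub_one h0 h1 (x := (n : ℝ) + 1) (by positivity)
  unfold rpowIncr
  push_cast
  linarith

theorem rpowIncr_zero (h0 : 0 < s) : rpowIncr s 0 = 1 / 2 := by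
  simp [rpowIncr, Real.zero_rpow h0.ne']

theorem rpowIncr_le_half (h0 : 0 < s) (h1 : s ≤ 1) (n : ℕ) : rpowIncr s n ≤ 1 / 2 :=
  rpowIncr_zero h0 ▸ antitone_rpowIncr h0.le h1 (Nat.zero_le n)

theorem rpowIncr_le_rpow (h0 : 0 ≤ s) (h1 : s ≤ 1) {n : ℕ} (hn : 0 < n) :
    rpowIncr s n ≤ (n : ℝ) ^ (s - 1) / 2 := by
  have h := rpow_sub_le_mul_rpow_sub_one h0 h1 (x := n) (by positivity)
  have h2 : s * (n : ℝ) ^ (s - 1) ≤ 1 * (n : ℝ) ^ (s - 1) := by gcongr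
  unfold rpowIncr
  linarith

theorem le_rpowIncr (h0 : 0 ≤ s) (h1 : s ≤ 1) (n : ℕ) :
    s / 2 * ((n : ℝ) + 1) ^ (s - 1) ≤ rpowIncr s n := by
  have h := mul_rpow_sub_one_le_rpow_sub h0 h1 (x := n) (by positivity)
  unfold rpowIncr
  linarith

theorem sum_Ico_rpowIncr (s : ℝ) {m n : ℕ} (h : m ≤ n) :
    ∑ i ∈ Finset.Ico m n, rpowIncr s i = ((n : ℝ) ^ s - (m : ℝ) ^ s) / 2 := by
  induction n, h using Nat.le_induction with
  | base => simp
  | succ n hmn ih =>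
    rw [Finset.sum_Ico_succ_top hmn, ih, rpowIncr]
    push_cast
    ring

end RpowIncr

/-- A sum of an antitone function over a finite set of indices `≥ c` is at most the sum over the
first indices `≥ c`. -/
theorem Antitone.sum_le_sum_Ico {w : ℕ → ℝ} (hw : Antitone w) (c : ℕ) (D : Finset ℕ)
    (hD : ∀ n ∈ D, c ≤ n) : ∑ n ∈ D, w n ≤ ∑ n ∈ Finset.Ico c (c + D.card), w n := by
  induction D using Finset.induction_on_max with
  | empty => simp
  | insert a D hmax ih =>
    have ha : a ∉ D := fun h => lt_irrefl _ (hmax a h)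
    rw [Finset.sum_insert ha, Finset.card_insert_of_notMem ha, ← add_assoc,
      Finset.sum_Ico_succ_top (by omega), add_comm]
    refine add_le_add (ih fun n hn => hD n (Finset.mem_insert_of_mem hn)) (hw ?_)
    have hsub : D ⊆ Finset.Ico c a := fun n hn =>
      Finset.mem_Ico.2 ⟨hD n (Finset.mem_insert_of_mem hn), hmax n hn⟩
    have h := Finset.card_le_card hsub
    have := hD a (Finset.mem_insert_self _ _)
    rw [Nat.card_Ico] at h
    omega

/-- An alternating sum of a nonnegative antitone function has the sign of its first term, and is
at most that term in modulus. -/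
theorem Antitone.neg_one_pow_mul_alternating_sum_mem_Icc {g : ℕ → ℝ} (hg : Antitone g)
    (h0 : ∀ n, 0 ≤ g n) (d k : ℕ) :
    (-1) ^ k * ∑ n ∈ Finset.Ico k (k + d), (-1) ^ n * g n ∈ Set.Icc 0 (g k) := by
  induction d generalizing k with
  | zero => simpa using h0 k
  | succ d ih =>
    obtain ⟨h1, h2⟩ := ih (k + 1)
    have hk := hg (Nat.le_succ k)
    rw [Finset.sum_eq_sum_Ico_succ_bot (by omega), mul_add, ← mul_assoc, ← mul_pow,
      show k + (d + 1) = k + 1 + d by omega]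
    rw [pow_succ] at h1 h2
    simp only [mul_neg_one, neg_mul, neg_neg, one_pow, one_mul] at *
    constructor <;> linarith

theorem Antitone.abs_alternating_sum_le {g : ℕ → ℝ} (hg : Antitone g) (h0 : ∀ n, 0 ≤ g n)
    (k l : ℕ) : |∑ n ∈ Finset.Ico k l, (-1) ^ n * g n| ≤ g k := by
  rcases le_total l k with h | h
  · simpa [Finset.Ico_eq_empty_of_le h] using h0 k
  · obtain ⟨d, rfl⟩ := Nat.exists_eq_add_of_le h
    obtain ⟨h1, h2⟩ := hg.neg_one_pow_mul_alternating_sum_mem_Icc h0 d k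
    rcases neg_one_pow_eq_or ℝ k with hk | hk <;> rw [hk] at h1 h2 <;> rw [abs_le] <;>
      constructor <;> linarith

theorem Antitone.sum_le_two_mul_sum_even {g : ℕ → ℝ} (hg : Antitone g) (h0 : ∀ n, 0 ≤ g n)
    (N : ℕ) : ∑ n ∈ Finset.range N, g n ≤
      2 * ∑ n ∈ Finset.range N, (if Even n then g n else 0) := by
  have h := (hg.neg_one_pow_mul_alternating_sum_mem_Icc h0 N 0).1
  rw [zero_add, pow_zero, one_mul, Nat.Ico_zero_eq_range] at h
  have : ∑ n ∈ Finset.range N, (-1) ^ n * g n =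
      2 * ∑ n ∈ Finset.range N, (if Even n then g n else 0) - ∑ n ∈ Finset.range N, g n := by
    rw [Finset.mul_sum, ← Finset.sum_sub_distrib]
    refine Finset.sum_congr rfl fun n _ => ?_
    rcases Nat.even_or_odd n with hn | hn
    · simp [hn, hn.neg_one_pow]; ring
    · simp [Nat.not_even_iff_odd.2 hn, hn.neg_one_pow]
  linarith

theorem log_succ_le_sum_range_inv (N : ℕ) :
    Real.log ((N : ℝ) + 1) ≤ ∑ n ∈ Finset.range N, ((n : ℝ) + 1)⁻¹ := by
  have h := log_add_one_le_harmonic N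
  simpa [harmonic] using h

section TruncNorm

variable {𝕜 : Type*} [RCLike 𝕜] {p : ℝ} {f g : ℕ → 𝕜}

/-- The expression over which `truncNorm` is the supremum. -/
noncomputable def truncTerm (p : ℝ) (B : Finset ℕ) (k l : ℕ) (f : ℕ → 𝕜) : ℝ :=
  (B.card : ℝ) ^ (1 / p - 1) * ∑ n ∈ B, ‖f n‖ +
    ‖∑ n ∈ Finset.Ico k l \ B, f n * (rpowIncr (1 / p) n : 𝕜)‖

theorem truncNorm_eq_iSup (p : ℝ) (f : ℕ → 𝕜) :
    truncNorm p f = ⨆ (B : Finset ℕ) (k : ℕ) (l : ℕ) (_ : B.card ≤ k),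
      ENNReal.ofReal (truncTerm p B k l f) := rfl

theorem ofReal_truncTerm_le_truncNorm {B : Finset ℕ} {k : ℕ} (h : B.card ≤ k) (l : ℕ) :
    ENNReal.ofReal (truncTerm p B k l f) ≤ truncNorm p f := by
  rw [truncNorm_eq_iSup]
  exact le_iSup₂_of_le B k (le_iSup₂_of_le l h le_rfl)

theorem truncNorm_le {M : ℝ≥0∞} (h : ∀ (B : Finset ℕ) (k l : ℕ), B.card ≤ k →
    ENNReal.ofReal (truncTerm p B k l f) ≤ M) : truncNorm p f ≤ M := by
  rw [truncNorm_eq_iSup]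
  exact iSup₂_le fun B k => iSup₂_le fun l hB => h B k l hB

theorem truncTerm_le_toReal (hf : truncNorm p f ≠ ⊤) {B : Finset ℕ} {k : ℕ} (h : B.card ≤ k)
    (l : ℕ) : truncTerm p B k l f ≤ (truncNorm p f).toReal :=
  (ENNReal.ofReal_le_iff_le_toReal hf).1 (ofReal_truncTerm_le_truncNorm h l)

theorem truncNorm_le_truncNorm (h : ∀ (B : Finset ℕ) (k l : ℕ), B.card ≤ k →
    ∃ (B' : Finset ℕ) (k' l' : ℕ), B'.card ≤ k' ∧
      truncTerm p B k l g ≤ truncTerm p B' k' l' f) : truncNorm p g ≤ truncNorm p f := by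
  refine truncNorm_le fun B k l hB => ?_
  obtain ⟨B', k', l', hB', hle⟩ := h B k l hB
  exact (ENNReal.ofReal_le_ofReal hle).trans (ofReal_truncTerm_le_truncNorm hB' l')

theorem truncNorm_zero : truncNorm p (0 : ℕ → 𝕜) = 0 :=
  le_antisymm (truncNorm_le fun B k l _ => by simp [truncTerm]) bot_le

theorem truncNorm_add_le (f g : ℕ → 𝕜) :
    truncNorm p (f + g) ≤ truncNorm p f + truncNorm p g := by
  refine truncNorm_le fun B k l hB => ?_
  have : truncTerm p B k l (f + g) ≤ truncTerm p B k l f + truncTerm p B k l g := by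
    have h1 : ∑ n ∈ B, ‖(f + g) n‖ ≤ ∑ n ∈ B, ‖f n‖ + ∑ n ∈ B, ‖g n‖ := by
      rw [← Finset.sum_add_distrib]
      exact Finset.sum_le_sum fun n _ => norm_add_le _ _
    have h2 := mul_le_mul_of_nonneg_left h1
      (by positivity : (0 : ℝ) ≤ (B.card : ℝ) ^ (1 / p - 1))
    have h3 := norm_add_le (∑ n ∈ Finset.Ico k l \ B, f n * (rpowIncr (1 / p) n : 𝕜))
      (∑ n ∈ Finset.Ico k l \ B, g n * (rpowIncr (1 / p) n : 𝕜))
    rw [← Finset.sum_add_distrib] at h3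
    simp only [truncTerm, Pi.add_apply, add_mul] at *
    linarith
  refine (ENNReal.ofReal_le_ofReal this).trans (ENNReal.ofReal_add_le.trans ?_)
  exact add_le_add (ofReal_truncTerm_le_truncNorm hB l) (ofReal_truncTerm_le_truncNorm hB l)

theorem truncTerm_smul (B : Finset ℕ) (k l : ℕ) (c : 𝕜) (f : ℕ → 𝕜) :
    truncTerm p B k l (c • f) = ‖c‖ * truncTerm p B k l f := by
  simp only [truncTerm, Pi.smul_apply, smul_eq_mul, norm_mul, mul_assoc, ← Finset.mul_sum]
  ring

theorem truncNorm_smul (c : 𝕜) (f : ℕ → 𝕜) :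
    truncNorm p (c • f) = ‖c‖ₑ * truncNorm p f := by
  simp only [truncNorm_eq_iSup, truncTerm_smul, ENNReal.mul_iSup,
    ENNReal.ofReal_mul (norm_nonneg c), ofReal_norm]

theorem enorm_le_truncNorm (f : ℕ → 𝕜) (n : ℕ) : ‖f n‖ₑ ≤ truncNorm p f := by
  have h := ofReal_truncTerm_le_truncNorm (p := p) (f := f) (B := {n}) (k := 1) (by simp) 1
  simpa [truncTerm] using h

theorem card_rpow_le_one (hp : 1 < p) (B : Finset ℕ) (hB : B.Nonempty) :
    (B.card : ℝ) ^ (1 / p - 1) ≤ 1 := by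
  have h1 : 1 / p < 1 := by rw [div_lt_one] <;> linarith
  exact Real.rpow_le_one_of_one_le_of_nonpos (by exact_mod_cast hB.card_pos) (by linarith)

theorem truncNorm_ne_top (hp : 1 < p) {N : ℕ} (hf : ∀ n, N ≤ n → f n = 0) :
    truncNorm p f ≠ ⊤ := by
  have h0 : 0 < 1 / p := by positivity
  have h1 : 1 / p ≤ 1 := by rw [div_le_one] <;> linarith
  have key : ∀ D : Finset ℕ, ∑ n ∈ D, ‖f n‖ ≤ ∑ n ∈ Finset.range N, ‖f n‖ := by
    intro D
    rw [← Finset.sum_filter_add_sum_filter_not D (· < N),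
      Finset.sum_eq_zero (s := D.filter (¬ · < N)), add_zero]
    · exact Finset.sum_le_sum_of_subset_of_nonneg (fun n hn => by simp_all)
        fun n _ _ => norm_nonneg _
    · intro n hn
      rw [hf n (by simpa using (Finset.mem_filter.1 hn).2), norm_zero]
  refine ne_top_of_le_ne_top (ENNReal.ofReal_ne_top (r := 2 * ∑ n ∈ Finset.range N, ‖f n‖))
    (truncNorm_le fun B k l hB => ENNReal.ofReal_le_ofReal ?_)
  have e1 : (B.card : ℝ) ^ (1 / p - 1) * ∑ n ∈ B, ‖f n‖ ≤ ∑ n ∈ Finset.range N, ‖f n‖ := by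
    rcases B.eq_empty_or_nonempty with rfl | hBn
    · simpa using Finset.sum_nonneg fun n _ => norm_nonneg (f n)
    · exact (mul_le_of_le_one_left (by positivity) (card_rpow_le_one hp B hBn)).trans (key B)
  have e2 : ‖∑ n ∈ Finset.Ico k l \ B, f n * (rpowIncr (1 / p) n : 𝕜)‖ ≤
      ∑ n ∈ Finset.range N, ‖f n‖ := by
    refine (norm_sum_le _ _).trans (le_trans (Finset.sum_le_sum fun n _ => ?_) (key _))
    rw [norm_mul, RCLike.norm_ofReal, abs_of_nonneg (rpowIncr_nonneg h0.le n)]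
    exact mul_le_of_le_one_right (norm_nonneg _)
      ((rpowIncr_le_half h0 h1 n).trans (by norm_num))
  unfold truncTerm
  linarith

theorem norm_mul_rpowIncr (hp : 1 < p) (f : ℕ → 𝕜) (n : ℕ) :
    ‖f n * (rpowIncr (1 / p) n : 𝕜)‖ = ‖f n‖ * rpowIncr (1 / p) n := by
  rw [norm_mul, RCLike.norm_ofReal, abs_of_nonneg (rpowIncr_nonneg (by positivity) n)]

/-- The powers of cardinals in `truncTerm` decrease when the set shrinks to one that carries the
whole sum. -/
theorem card_rpow_mul_sum_le (hp : 1 < p) {B B' : Finset ℕ} (h : B' ⊆ B) {u : ℕ → ℝ}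
    (hu : ∀ n, 0 ≤ u n) : (B.card : ℝ) ^ (1 / p - 1) * ∑ n ∈ B', u n ≤
      (B'.card : ℝ) ^ (1 / p - 1) * ∑ n ∈ B', u n := by
  have h1 : 1 / p < 1 := by rw [div_lt_one] <;> linarith
  rcases B'.eq_empty_or_nonempty with rfl | hne
  · simp
  · refine mul_le_mul_of_nonneg_right ?_ (Finset.sum_nonneg fun n _ => hu n)
    exact Real.rpow_le_rpow_of_nonpos (by exact_mod_cast hne.card_pos)
      (by exact_mod_cast Finset.card_le_card h) (by linarith)

theorem truncTerm_indicator_le (hp : 1 < p) (S : Set ℕ) [DecidablePred (· ∈ S)]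
    (B : Finset ℕ) (k l : ℕ) (f : ℕ → 𝕜) : truncTerm p B k l (S.indicator f) ≤
      ((B.filter (· ∈ S)).card : ℝ) ^ (1 / p - 1) * ∑ n ∈ B.filter (· ∈ S), ‖f n‖ +
      ‖∑ n ∈ (Finset.Ico k l \ B).filter (· ∈ S), f n * (rpowIncr (1 / p) n : 𝕜)‖ := by
  have e1 : ∑ n ∈ B, ‖S.indicator f n‖ = ∑ n ∈ B.filter (· ∈ S), ‖f n‖ := by
    rw [Finset.sum_filter]
    exact Finset.sum_congr rfl fun n _ => by by_cases h : n ∈ S <;> simp [h]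
  have e2 : ∑ n ∈ Finset.Ico k l \ B, S.indicator f n * (rpowIncr (1 / p) n : 𝕜) =
      ∑ n ∈ (Finset.Ico k l \ B).filter (· ∈ S), f n * (rpowIncr (1 / p) n : 𝕜) := by
    rw [Finset.sum_filter]
    exact Finset.sum_congr rfl fun n _ => by by_cases h : n ∈ S <;> simp [h]
  rw [truncTerm, e1, e2]
  gcongr ?_ + _
  exact card_rpow_mul_sum_le hp (Finset.filter_subset _ _) fun n => norm_nonneg _

theorem truncNorm_indicator_Ici_le (hp : 1 < p) (a : ℕ) (f : ℕ → 𝕜) :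
    truncNorm p ((Set.Ici a).indicator f) ≤ truncNorm p f := by
  refine truncNorm_le_truncNorm fun B k l hB =>
    ⟨B.filter (· ∈ Set.Ici a), max k a, l,
      (Finset.card_filter_le _ _).trans (hB.trans (le_max_left _ _)),
      (truncTerm_indicator_le hp _ B k l f).trans_eq ?_⟩
  have : (Finset.Ico k l \ B).filter (· ∈ Set.Ici a) =
      Finset.Ico (max k a) l \ B.filter (· ∈ Set.Ici a) := by
    ext n; by_cases hn : n ∈ B <;> simp [hn] <;> omega
  rw [this, truncTerm]

theorem truncNorm_indicator_Iio_le (hp : 1 < p) (a : ℕ) (f : ℕ → 𝕜) :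
    truncNorm p ((Set.Iio a).indicator f) ≤ truncNorm p f := by
  refine truncNorm_le_truncNorm fun B k l hB =>
    ⟨B.filter (· ∈ Set.Iio a), k, min l a, (Finset.card_filter_le _ _).trans hB,
      (truncTerm_indicator_le hp _ B k l f).trans_eq ?_⟩
  have : (Finset.Ico k l \ B).filter (· ∈ Set.Iio a) =
      Finset.Ico k (min l a) \ B.filter (· ∈ Set.Iio a) := by
    ext n; by_cases hn : n ∈ B <;> simp [hn]; omega
  rw [this, truncTerm]

/-- Removing a greedy set of coefficients does not increase the norm. -/
theorem truncNorm_indicator_compl_le (hp : 1 < p) {A : Finset ℕ}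
    (hA : ∀ n ∈ A, ∀ k ∉ A, ‖f k‖ ≤ ‖f n‖) :
    truncNorm p ((A : Set ℕ)ᶜ.indicator f) ≤ truncNorm p f := by
  have h0 : 0 < 1 / p := by positivity
  have h1 : 1 / p < 1 := by rw [div_lt_one] <;> linarith
  rcases A.eq_empty_or_nonempty with rfl | hne
  · simp
  obtain ⟨n₀, hn₀, hmin⟩ := A.exists_min_image (fun n => ‖f n‖) hne
  set t := ‖f n₀‖ with ht
  have ht0 : 0 ≤ t := norm_nonneg _
  refine truncNorm_le_truncNorm fun B k l hB => ?_
  set B₁ := B.filter (· ∈ (A : Set ℕ)ᶜ) with hB₁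
  have hdisj : Disjoint B₁ A := by
    rw [Finset.disjoint_left]; intro n hn; simpa [hB₁] using (Finset.mem_filter.1 hn).2
  have hcard : (B₁ ∪ A).card = B₁.card + A.card := Finset.card_union_of_disjoint hdisj
  have hB₁B : B₁.card ≤ B.card := Finset.card_filter_le _ _
  set m := B₁.card with hm
  set a := A.card with ha
  have hapos : 0 < a := hne.card_pos
  refine ⟨B₁ ∪ A, max k (m + a), l, by rw [hcard]; exact le_max_right _ _,
    (truncTerm_indicator_le hp _ B k l f).trans ?_⟩
  rw [truncTerm, hcard, Finset.sum_union hdisj]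
  have hset : (Finset.Ico k l \ B).filter (· ∈ (A : Set ℕ)ᶜ) = Finset.Ico k l \ (B₁ ∪ A) := by
    ext n; simp [hB₁]; tauto
  have hsplit : Finset.Ico k l \ (B₁ ∪ A) = (Finset.Ico (max k (m + a)) l \ (B₁ ∪ A)) ∪
      ((Finset.Ico k l \ (B₁ ∪ A)).filter (· < m + a)) := by
    ext n; simp only [Finset.mem_union, Finset.mem_sdiff, Finset.mem_Ico, Finset.mem_filter]
    constructor
    · intro h
      rcases lt_or_ge n (m + a) with h' | h'
      · exact Or.inr ⟨h, h'⟩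
      · exact Or.inl ⟨⟨max_le h.1.1 h', h.1.2⟩, h.2⟩
    · rintro (h | h)
      · exact ⟨⟨(le_max_left _ _).trans h.1.1, h.1.2⟩, h.2⟩
      · exact h.1
  have hsd : Disjoint (Finset.Ico (max k (m + a)) l \ (B₁ ∪ A))
      ((Finset.Ico k l \ (B₁ ∪ A)).filter (· < m + a)) := by
    rw [Finset.disjoint_left]
    intro n hn hn'
    have e1 := (Finset.mem_Ico.1 (Finset.mem_sdiff.1 hn).1).1
    have e2 := (Finset.mem_filter.1 hn').2
    exact absurd ((le_max_right _ _).trans e1) (not_le.2 e2)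
  have hloss : ‖∑ n ∈ (Finset.Ico k l \ (B₁ ∪ A)).filter (· < m + a),
      f n * (rpowIncr (1 / p) n : 𝕜)‖ ≤
      t * ((((m + a : ℕ) : ℝ) ^ (1 / p) - (m : ℝ) ^ (1 / p)) / 2) := by
    rw [← sum_Ico_rpowIncr _ (Nat.le_add_right m a), Finset.mul_sum]
    refine (norm_sum_le _ _).trans ?_
    refine (Finset.sum_le_sum (g := fun n => t * rpowIncr (1 / p) n) fun n hn => ?_).trans
      (Finset.sum_le_sum_of_subset_of_nonneg (fun n hn => ?_) fun n _ _ =>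
        mul_nonneg ht0 (rpowIncr_nonneg h0.le n))
    · rw [norm_mul_rpowIncr hp]
      refine mul_le_mul_of_nonneg_right (hA n₀ hn₀ n fun hnA => ?_) (rpowIncr_nonneg h0.le n)
      simp [hnA] at hn
    · simp only [Finset.mem_filter, Finset.mem_sdiff, Finset.mem_Ico] at hn ⊢
      omega
  have hnorm := norm_add_le
    (∑ n ∈ Finset.Ico (max k (m + a)) l \ (B₁ ∪ A), f n * (rpowIncr (1 / p) n : 𝕜))
    (∑ n ∈ (Finset.Ico k l \ (B₁ ∪ A)).filter (· < m + a), f n * (rpowIncr (1 / p) n : 𝕜))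
  rw [← Finset.sum_union hsd, ← hsplit] at hnorm
  rw [hset]
  have hsA : (a : ℝ) * t ≤ ∑ n ∈ A, ‖f n‖ := by
    rw [← nsmul_eq_mul]
    exact Finset.card_nsmul_le_sum A (fun n => ‖f n‖) t hmin
  have hsB : ∑ n ∈ B₁, ‖f n‖ ≤ m * t := by
    rw [← nsmul_eq_mul]
    exact Finset.sum_le_card_nsmul B₁ (fun n => ‖f n‖) t fun n hn =>
      hA n₀ hn₀ n fun hnA => Finset.disjoint_left.1 hdisj hn hnA
  have hsB0 : 0 ≤ ∑ n ∈ B₁, ‖f n‖ := Finset.sum_nonneg fun n _ => norm_nonneg _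
  have hma : (0 : ℝ) < ((m + a : ℕ) : ℝ) := by exact_mod_cast (by omega : 0 < m + a)
  set v := ((m + a : ℕ) : ℝ) ^ (1 / p - 1) with hv
  have hv0 : 0 ≤ v := Real.rpow_nonneg hma.le _
  have hvs : ((m + a : ℕ) : ℝ) ^ (1 / p) = v * (m + a) := by
    rw [hv, Real.rpow_sub_one hma.ne']; push_cast; field_simp
  have hmono : (m : ℝ) ^ (1 / p) ≤ ((m + a : ℕ) : ℝ) ^ (1 / p) :=
    Real.rpow_le_rpow (Nat.cast_nonneg m) (by push_cast; linarith [(Nat.cast_nonneg a : (0:ℝ) ≤ a)])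
      h0.le
  have hgain : (m : ℝ) ^ (1 / p - 1) * ∑ n ∈ B₁, ‖f n‖ - v * ∑ n ∈ B₁, ‖f n‖ ≤
      ((m : ℝ) ^ (1 / p) - v * m) * t := by
    rcases Nat.eq_zero_or_pos m with h | h
    · have : B₁ = ∅ := Finset.card_eq_zero.1 (hm ▸ h)
      simp [this, h, (by positivity : p ≠ 0)]
    · have hm0 : (0 : ℝ) < m := by exact_mod_cast h
      have hu : (m : ℝ) ^ (1 / p) = (m : ℝ) ^ (1 / p - 1) * m := by
        rw [Real.rpow_sub_one hm0.ne']; field_simp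
      have huv : v ≤ (m : ℝ) ^ (1 / p - 1) :=
        Real.rpow_le_rpow_of_nonpos hm0 (by push_cast; linarith [(Nat.cast_nonneg a : (0:ℝ) ≤ a)])
          (by linarith)
      rw [hu]
      have := mul_le_mul_of_nonneg_left hsB (sub_nonneg.2 huv)
      linarith
  have h4 := mul_le_mul_of_nonneg_left hsA hv0
  have h5 := mul_nonneg ht0 (sub_nonneg.2 hmono)
  rw [hvs] at h5 hloss
  linarith

end TruncNorm

section TruncNormEstimates

variable {𝕜 : Type*} [RCLike 𝕜] {p : ℝ} {f : ℕ → 𝕜}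

theorem card_rpow_sub_one_mul_le {B : Finset ℕ} (hB : B.Nonempty) {s x : ℝ}
    (hx : x ≤ B.card) : (B.card : ℝ) ^ (s - 1) * x ≤ (B.card : ℝ) ^ s := by
  have hc : (0 : ℝ) < B.card := by exact_mod_cast hB.card_pos
  calc _ ≤ (B.card : ℝ) ^ (s - 1) * B.card := by gcongr
    _ = _ := by rw [Real.rpow_sub_one hc.ne']; field_simp

theorem truncNorm_le_card_rpow (hp : 1 < p) {A : Finset ℕ} (hA : ∀ n ∈ A, ‖f n‖ ≤ 1)
    (h0 : ∀ n ∉ A, f n = 0) : truncNorm p f ≤ (A.card : ℝ≥0∞) ^ (1 / p) := by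
  have hs0 : 0 < 1 / p := by positivity
  have hs1 : 1 / p < 1 := by rw [div_lt_one] <;> linarith
  have hf : f = (A : Set ℕ).indicator f := by
    ext n; by_cases h : n ∈ A <;> simp [h, h0]
  rw [← ENNReal.ofReal_natCast, ENNReal.ofReal_rpow_of_nonneg (Nat.cast_nonneg _) hs0.le, hf]
  refine truncNorm_le fun B k l hB => ENNReal.ofReal_le_ofReal
    ((truncTerm_indicator_le hp _ B k l f).trans ?_)
  set B' := B.filter (· ∈ (A : Set ℕ)) with hB'
  set D := (Finset.Ico k l \ B).filter (· ∈ (A : Set ℕ)) with hD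
  have hB'B : B'.card ≤ B.card := Finset.card_filter_le _ _
  have hdisj : Disjoint B' D := by
    rw [Finset.disjoint_left]
    intro n h1 h2
    exact (Finset.mem_sdiff.1 (Finset.mem_filter.1 h2).1).2 (Finset.mem_filter.1 h1).1
  have hcard : B'.card + D.card ≤ A.card := by
    rw [← Finset.card_union_of_disjoint hdisj]
    refine Finset.card_le_card fun n hn => ?_
    rcases Finset.mem_union.1 hn with h | h <;> simpa using (Finset.mem_filter.1 h).2
  have e1 : (B'.card : ℝ) ^ (1 / p - 1) * ∑ n ∈ B', ‖f n‖ ≤ (B'.card : ℝ) ^ (1 / p) := by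
    rcases B'.eq_empty_or_nonempty with h | h
    · simp [h, (by positivity : p ≠ 0)]
    · have h1 : ∑ n ∈ B', ‖f n‖ ≤ B'.card := by
        have := Finset.sum_le_card_nsmul B' (fun n => ‖f n‖) 1 fun n hn =>
          hA n (by simpa using (Finset.mem_filter.1 hn).2)
        simpa using this
      exact card_rpow_sub_one_mul_le h h1
  have e2 : ‖∑ n ∈ D, f n * (rpowIncr (1 / p) n : 𝕜)‖ ≤
      ((A.card : ℝ) ^ (1 / p) - (B'.card : ℝ) ^ (1 / p)) / 2 := by
    calc _ ≤ ∑ n ∈ D, rpowIncr (1 / p) n := by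
          refine (norm_sum_le _ _).trans (Finset.sum_le_sum fun n hn => ?_)
          rw [norm_mul_rpowIncr hp]
          exact mul_le_of_le_one_left (rpowIncr_nonneg hs0.le n)
            (hA n (by simpa using (Finset.mem_filter.1 hn).2))
      _ ≤ ∑ n ∈ Finset.Ico B'.card (B'.card + D.card), rpowIncr (1 / p) n := by
          refine (antitone_rpowIncr hs0.le hs1.le).sum_le_sum_Ico _ D fun n hn => ?_
          have := (Finset.mem_Ico.1 (Finset.mem_sdiff.1 (Finset.mem_filter.1 hn).1).1).1
          omega
      _ ≤ ∑ n ∈ Finset.Ico B'.card A.card, rpowIncr (1 / p) n :=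
          Finset.sum_le_sum_of_subset_of_nonneg (Finset.Ico_subset_Ico_right hcard)
            fun n _ _ => rpowIncr_nonneg hs0.le n
      _ = _ := sum_Ico_rpowIncr _ (by omega)
  have e3 : (B'.card : ℝ) ^ (1 / p) ≤ (A.card : ℝ) ^ (1 / p) :=
    Real.rpow_le_rpow (Nat.cast_nonneg _) (by exact_mod_cast (by omega)) hs0.le
  linarith

theorem sum_norm_le_card_rpow_mul (hf : truncNorm p f ≠ ⊤) (B : Finset ℕ) :
    ∑ n ∈ B, ‖f n‖ ≤ (B.card : ℝ) ^ (1 - 1 / p) * (truncNorm p f).toReal := by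
  rcases B.eq_empty_or_nonempty with rfl | h
  · simpa using mul_nonneg (Real.rpow_nonneg le_rfl (1 - p⁻¹)) ENNReal.toReal_nonneg
  have hc : (0 : ℝ) < B.card := by exact_mod_cast h.card_pos
  have hle := truncTerm_le_toReal hf (le_refl B.card) B.card
  simp only [truncTerm, Finset.Ico_self, Finset.empty_sdiff, Finset.sum_empty, norm_zero,
    add_zero] at hle
  rw [← neg_sub, Real.rpow_neg hc.le, inv_mul_le_iff₀ (by positivity)] at hle
  exact hle

theorem sum_norm_mul_rpowIncr_le (hp : 1 < p) (hf : truncNorm p f ≠ ⊤) {r : ℕ} {A : Finset ℕ}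
    (hA : A.card ≤ 2 ^ r) :
    ∑ n ∈ A, ‖f n‖ * rpowIncr (1 / p) n ≤ (r + 1) * (truncNorm p f).toReal := by
  have hs0 : 0 < 1 / p := by positivity
  have hs1 : 1 / p < 1 := by rw [div_lt_one] <;> linarith
  have hM : 0 ≤ (truncNorm p f).toReal := ENNReal.toReal_nonneg
  induction r generalizing A with
  | zero =>
    have h1 := sum_norm_le_card_rpow_mul hf A
    have h2 : (A.card : ℝ) ^ (1 - 1 / p) ≤ 1 :=
      Real.rpow_le_one (Nat.cast_nonneg _) (by exact_mod_cast hA) (by linarith)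
    have h3 : ∑ n ∈ A, ‖f n‖ * rpowIncr (1 / p) n ≤ ∑ n ∈ A, ‖f n‖ :=
      Finset.sum_le_sum fun n _ => mul_le_of_le_one_right (norm_nonneg _)
        ((rpowIncr_le_half hs0 hs1.le n).trans (by norm_num))
    have h4 := mul_le_mul_of_nonneg_right h2 hM
    simp only [Nat.cast_zero]
    linarith
  | succ r ih =>
    rw [← Finset.sum_filter_add_sum_filter_not A (· < 2 ^ r)]
    have h1 : (A.filter (· < 2 ^ r)).card ≤ 2 ^ r := by
      refine (Finset.card_le_card (t := Finset.range (2 ^ r)) fun n hn => ?_).trans_eq (by simp)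
      simpa using (Finset.mem_filter.1 hn).2
    have h2 := ih h1
    set U := A.filter (¬ · < 2 ^ r) with hU
    have hUc : (U.card : ℝ) ≤ 2 * 2 ^ r := by
      have : U.card ≤ 2 ^ (r + 1) := (Finset.card_filter_le _ _).trans hA
      rw [pow_succ, mul_comm] at this
      exact_mod_cast this
    have hpow : (0 : ℝ) < 2 ^ r := by positivity
    have h3 : ∑ n ∈ U, ‖f n‖ * rpowIncr (1 / p) n ≤
        (∑ n ∈ U, ‖f n‖) * (((2 : ℝ) ^ r) ^ (1 / p - 1) / 2) := by
      rw [Finset.sum_mul]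
      refine Finset.sum_le_sum fun n hn => mul_le_mul_of_nonneg_left ?_ (norm_nonneg _)
      have hn' : 2 ^ r ≤ n := by simpa using (Finset.mem_filter.1 hn).2
      refine (antitone_rpowIncr hs0.le hs1.le hn').trans ?_
      simpa using rpowIncr_le_rpow hs0.le hs1.le (Nat.two_pow_pos r)
    have h4 : (U.card : ℝ) ^ (1 - 1 / p) ≤ 2 * ((2 : ℝ) ^ r) ^ (1 - 1 / p) := by
      refine (Real.rpow_le_rpow (Nat.cast_nonneg _) hUc (by linarith)).trans ?_
      rw [Real.mul_rpow (by norm_num) hpow.le]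
      gcongr
      calc (2 : ℝ) ^ (1 - 1 / p) ≤ 2 ^ (1 : ℝ) :=
            Real.rpow_le_rpow_of_exponent_le (by norm_num) (by linarith)
        _ = 2 := by simp
    have h5 : ((2 : ℝ) ^ r) ^ (1 - 1 / p) * ((2 : ℝ) ^ r) ^ (1 / p - 1) = 1 := by
      rw [← Real.rpow_add hpow]; simp
    have h6 : ∑ n ∈ U, ‖f n‖ * rpowIncr (1 / p) n ≤ (truncNorm p f).toReal := by
      calc _ ≤ _ := h3
        _ ≤ ((U.card : ℝ) ^ (1 - 1 / p) * (truncNorm p f).toReal) *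
            (((2 : ℝ) ^ r) ^ (1 / p - 1) / 2) := by
          gcongr; exact sum_norm_le_card_rpow_mul hf U
        _ ≤ (2 * ((2 : ℝ) ^ r) ^ (1 - 1 / p) * (truncNorm p f).toReal) *
            (((2 : ℝ) ^ r) ^ (1 / p - 1) / 2) := by gcongr
        _ = (((2 : ℝ) ^ r) ^ (1 - 1 / p) * ((2 : ℝ) ^ r) ^ (1 / p - 1)) *
            (truncNorm p f).toReal := by ring
        _ = _ := by rw [h5, one_mul]
    push_cast
    linarith

theorem truncNorm_indicator_le (hp : 1 < p) (hf : truncNorm p f ≠ ⊤) {r : ℕ} {A : Finset ℕ}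
    (hA : A.card ≤ 2 ^ r) :
    truncNorm p ((A : Set ℕ).indicator f) ≤ (r + 2) * truncNorm p f := by
  have hM : ((r : ℝ≥0∞) + 2) * truncNorm p f =
      ENNReal.ofReal ((r + 2) * (truncNorm p f).toReal) := by
    rw [ENNReal.ofReal_mul (by positivity), ENNReal.ofReal_toReal hf,
      ENNReal.ofReal_add (by positivity) (by positivity)]
    simp
  rw [hM]
  refine truncNorm_le fun B k l hB => ENNReal.ofReal_le_ofReal
    ((truncTerm_indicator_le hp _ B k l f).trans ?_)
  set B' := B.filter (· ∈ (A : Set ℕ))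
  set D := (Finset.Ico k l \ B).filter (· ∈ (A : Set ℕ)) with hD
  have h1 := truncTerm_le_toReal hf (le_refl B'.card) B'.card
  simp only [truncTerm, Finset.Ico_self, Finset.empty_sdiff, Finset.sum_empty, norm_zero,
    add_zero] at h1
  have hDA : D ⊆ A := fun n hn => by simpa using (Finset.mem_filter.1 hn).2
  have h2 := sum_norm_mul_rpowIncr_le hp hf ((Finset.card_le_card hDA).trans hA)
  have h3 := norm_sum_le D fun n => f n * (rpowIncr (1 / p) n : 𝕜)
  simp only [norm_mul_rpowIncr hp] at h3
  linarith

end TruncNormEstimates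

section AlternatingSeq

/-- The alternating sequence `(-1) ^ n (n + 1) ^ (-1 / p)`, truncated to its first `N` terms. -/
noncomputable def altSeq (𝕜 : Type*) [RCLike 𝕜] (p : ℝ) (N n : ℕ) : 𝕜 :=
  if n < N then (((-1) ^ n * ((n : ℝ) + 1) ^ (-(1 / p)) : ℝ) : 𝕜) else 0

variable {𝕜 : Type*} [RCLike 𝕜] {p : ℝ}

theorem antitone_succ_rpow_neg {s : ℝ} (hs : 0 ≤ s) :
    Antitone fun n : ℕ => ((n : ℝ) + 1) ^ (-s) := fun m n h =>
  Real.rpow_le_rpow_of_nonpos (by positivity)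
    (by have : (m : ℝ) ≤ n := by exact_mod_cast h
        linarith) (by linarith)

theorem succ_rpow_neg_le_one {s : ℝ} (hs : 0 ≤ s) (n : ℕ) : ((n : ℝ) + 1) ^ (-s) ≤ 1 :=
  Real.rpow_le_one_of_one_le_of_nonpos (by linarith [(Nat.cast_nonneg n : (0 : ℝ) ≤ n)])
    (by linarith)

theorem norm_altSeq_le (N n : ℕ) : ‖altSeq 𝕜 p N n‖ ≤ ((n : ℝ) + 1) ^ (-(1 / p)) := by
  have h : (0 : ℝ) ≤ ((n : ℝ) + 1) ^ (-(1 / p)) := by positivity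
  unfold altSeq
  split_ifs
  · rw [RCLike.norm_ofReal, abs_mul, abs_pow, abs_neg, abs_one, one_pow, one_mul,
      abs_of_nonneg h]
  · rwa [norm_zero]

theorem sum_succ_rpow_neg_le {s : ℝ} (h0 : 0 < s) (h1 : s < 1) (B : Finset ℕ) :
    ∑ n ∈ B, ((n : ℝ) + 1) ^ (-s) ≤ (B.card : ℝ) ^ (1 - s) / (1 - s) := by
  refine ((antitone_succ_rpow_neg h0.le).sum_le_sum_Ico 0 B fun n _ => Nat.zero_le n).trans ?_
  have h := sum_Ico_rpowIncr (1 - s) (Nat.zero_le (0 + B.card))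
  have h2 : ∑ n ∈ Finset.Ico 0 (0 + B.card), (1 - s) / 2 * ((n : ℝ) + 1) ^ (-s) ≤
      ∑ n ∈ Finset.Ico 0 (0 + B.card), rpowIncr (1 - s) n := Finset.sum_le_sum fun n _ => by
    have := le_rpowIncr (s := 1 - s) (by linarith) (by linarith) n
    rwa [show 1 - s - 1 = -s by ring] at this
  rw [h, ← Finset.mul_sum, zero_add, Nat.cast_zero, Real.zero_rpow (by linarith)] at h2
  rw [zero_add, le_div_iff₀ (by linarith)]
  linarith

theorem truncNorm_altSeq_le (hp : 1 < p) (N : ℕ) :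
    truncNorm p (altSeq 𝕜 p N) ≤ ENNReal.ofReal (1 / (1 - 1 / p) + 1) := by
  have hs0 : 0 < 1 / p := by positivity
  have hs1 : 1 / p < 1 := by rw [div_lt_one] <;> linarith
  refine truncNorm_le fun B k l hB => ENNReal.ofReal_le_ofReal ?_
  set h : ℕ → ℝ := fun n => ((n : ℝ) + 1) ^ (-(1 / p)) * rpowIncr (1 / p) n with hh
  have hanti : Antitone h := fun m n hmn =>
    mul_le_mul (antitone_succ_rpow_neg hs0.le hmn) (antitone_rpowIncr hs0.le hs1.le hmn)
      (rpowIncr_nonneg hs0.le n) (by positivity)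
  have hnn : ∀ n, 0 ≤ h n := fun n => mul_nonneg (by positivity) (rpowIncr_nonneg hs0.le n)
  have e1 : (B.card : ℝ) ^ (1 / p - 1) * ∑ n ∈ B, ‖altSeq 𝕜 p N n‖ ≤ 1 / (1 - 1 / p) := by
    rcases B.eq_empty_or_nonempty with rfl | hne
    · simpa using hs1.le
    have hc : (0 : ℝ) < B.card := by exact_mod_cast hne.card_pos
    calc _ ≤ (B.card : ℝ) ^ (1 / p - 1) * ((B.card : ℝ) ^ (1 - 1 / p) / (1 - 1 / p)) := by
          gcongr
          exact (Finset.sum_le_sum fun n _ => norm_altSeq_le N n).trans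
            (sum_succ_rpow_neg_le hs0 hs1 B)
      _ = _ := by rw [← mul_div_assoc, ← Real.rpow_add hc]; simp
  have e2 : ‖∑ n ∈ Finset.Ico k l \ B, altSeq 𝕜 p N n * (rpowIncr (1 / p) n : 𝕜)‖ ≤ 1 := by
    have hsum : ∑ n ∈ Finset.Ico k l \ B, altSeq 𝕜 p N n * (rpowIncr (1 / p) n : 𝕜) =
        ((∑ n ∈ Finset.Ico k (min l N) \ B, (-1) ^ n * h n : ℝ) : 𝕜) := by
      have : Finset.Ico k (min l N) \ B = (Finset.Ico k l \ B).filter (· < N) := by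
        ext n; simp only [Finset.mem_sdiff, Finset.mem_Ico, Finset.mem_filter, lt_min_iff]; tauto
      rw [this, Finset.sum_filter, RCLike.ofReal_sum]
      refine Finset.sum_congr rfl fun n _ => ?_
      unfold altSeq
      split_ifs
      · simp only [hh]; push_cast; ring
      · simp
    rw [hsum, RCLike.norm_ofReal]
    have hsp := Finset.sum_inter_add_sum_sdiff (Finset.Ico k (min l N)) B
      fun n => (-1) ^ n * h n
    have hA := hanti.abs_alternating_sum_le hnn k (min l N)
    have hk : h k ≤ 1 / 2 := by
      have := mul_le_mul (succ_rpow_neg_le_one hs0.le k) (rpowIncr_le_half hs0 hs1.le k)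
        (rpowIncr_nonneg hs0.le k) zero_le_one
      simpa [hh] using this
    have hI : |∑ n ∈ Finset.Ico k (min l N) ∩ B, (-1) ^ n * h n| ≤ 1 / 2 := by
      rcases B.eq_empty_or_nonempty with rfl | hne
      · simp
      have hc : (0 : ℝ) < B.card := by exact_mod_cast hne.card_pos
      refine (Finset.abs_sum_le_sum_abs _ _).trans ?_
      have hb : ∀ n ∈ Finset.Ico k (min l N) ∩ B, |(-1) ^ n * h n| ≤ 1 / (2 * B.card) := by
        intro n hn
        have hkn : B.card ≤ n := hB.trans (by simp at hn; exact hn.1.1)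
        have hn0 : 0 < n := hne.card_pos.trans_le hkn
        have hnr : (0 : ℝ) < n := by exact_mod_cast hn0
        rw [abs_mul, abs_pow, abs_neg, abs_one, one_pow, one_mul, abs_of_nonneg (hnn n)]
        calc h n ≤ (n : ℝ) ^ (-(1 / p)) * ((n : ℝ) ^ (1 / p - 1) / 2) := by
              refine mul_le_mul (Real.rpow_le_rpow_of_nonpos hnr (by linarith) (by linarith))
                (rpowIncr_le_rpow hs0.le hs1.le hn0) (rpowIncr_nonneg hs0.le n) (by positivity)
          _ = 1 / (2 * n) := by
              rw [← mul_div_assoc, ← Real.rpow_add hnr,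
                show -(1 / p) + (1 / p - 1) = -1 by ring, Real.rpow_neg_one]
              field_simp
          _ ≤ _ := by gcongr
      refine (Finset.sum_le_card_nsmul _ _ _ hb).trans ?_
      rw [nsmul_eq_mul]
      have : ((Finset.Ico k (min l N) ∩ B).card : ℝ) ≤ B.card := by
        exact_mod_cast Finset.card_le_card Finset.inter_subset_right
      calc _ ≤ (B.card : ℝ) * (1 / (2 * B.card)) := by gcongr
        _ = 1 / 2 := by field_simp
    rw [abs_le] at *
    constructor <;> linarith
  unfold truncTerm
  linarith

theorem log_le_truncNorm_indicator_even (hp : 1 < p) (N : ℕ) :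
    ENNReal.ofReal (1 / p / 4 * Real.log ((N : ℝ) + 1)) ≤
      truncNorm p (Set.indicator {n | Even n} (altSeq 𝕜 p N)) := by
  have hs0 : 0 < 1 / p := by positivity
  have hs1 : 1 / p < 1 := by rw [div_lt_one] <;> linarith
  refine le_trans (ENNReal.ofReal_le_ofReal ?_)
    (ofReal_truncTerm_le_truncNorm (B := ∅) (k := 0) (by simp) N)
  have hsum : ∑ n ∈ Finset.Ico 0 N \ ∅,
      Set.indicator {n | Even n} (altSeq 𝕜 p N) n * (rpowIncr (1 / p) n : 𝕜) =
      ((∑ n ∈ Finset.range N, (if Even n then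
        ((n : ℝ) + 1) ^ (-(1 / p)) * rpowIncr (1 / p) n else 0) : ℝ) : 𝕜) := by
    rw [Finset.sdiff_empty, Nat.Ico_zero_eq_range, RCLike.ofReal_sum]
    refine Finset.sum_congr rfl fun n hn => ?_
    by_cases h : Even n
    · simp [h, altSeq, Finset.mem_range.1 hn, h.neg_one_pow]
    · simp [h]
  have hanti : Antitone fun n : ℕ => ((n : ℝ) + 1)⁻¹ := by
    simpa [Real.rpow_neg_one] using antitone_succ_rpow_neg (s := 1) zero_le_one
  have h1 := hanti.sum_le_two_mul_sum_even (fun n => by positivity) N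
  have h2 := log_succ_le_sum_range_inv N
  have h3 : 1 / p / 2 * ∑ n ∈ Finset.range N, (if Even n then ((n : ℝ) + 1)⁻¹ else 0) ≤
      ∑ n ∈ Finset.range N, (if Even n then
        ((n : ℝ) + 1) ^ (-(1 / p)) * rpowIncr (1 / p) n else 0) := by
    rw [Finset.mul_sum]
    refine Finset.sum_le_sum fun n _ => ?_
    split_ifs
    · have hn : (0 : ℝ) < (n : ℝ) + 1 := by positivity
      calc 1 / p / 2 * ((n : ℝ) + 1)⁻¹ =
            ((n : ℝ) + 1) ^ (-(1 / p)) * (1 / p / 2 * ((n : ℝ) + 1) ^ (1 / p - 1)) := by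
            rw [← Real.rpow_neg_one, show (-1 : ℝ) = -(1 / p) + (1 / p - 1) by ring,
              Real.rpow_add hn]
            ring_nf
        _ ≤ _ := by
            gcongr
            exact le_rpowIncr hs0.le hs1.le n
    · simp
  rw [truncTerm, hsum, RCLike.norm_ofReal]
  refine le_trans ?_ (le_add_of_nonneg_of_le (by positivity) (le_abs_self _))
  have h4 : 1 / p / 4 * Real.log ((N : ℝ) + 1) ≤ 1 / p / 4 *
      (2 * ∑ n ∈ Finset.range N, (if Even n then ((n : ℝ) + 1)⁻¹ else 0)) := by
    gcongr; exact h2.trans h1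
  linarith

end AlternatingSeq

section BlockSumNorm

variable {𝕜 : Type*} [RCLike 𝕜] {p : ℝ}

/-- The part of `A` in the `k`-th dyadic block, shifted to start at `0`. -/
def blockPart (A : Finset ℕ) (k : ℕ) : Finset ℕ :=
  (Finset.range (2 ^ k)).filter fun j => 2 ^ k - 1 + j ∈ A

theorem mem_blockPart {A : Finset ℕ} {k j : ℕ} :
    j ∈ blockPart A k ↔ j < 2 ^ k ∧ 2 ^ k - 1 + j ∈ A := by simp [blockPart]

theorem log_two_block {k j : ℕ} (hj : j < 2 ^ k) : Nat.log 2 (2 ^ k - 1 + j + 1) = k := by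
  have h := Nat.two_pow_pos k
  refine Nat.log_eq_of_pow_le_of_lt_pow (by omega) ?_
  rw [pow_succ]; omega

theorem sub_lt_two_pow_log (n : ℕ) : n + 1 - 2 ^ Nat.log 2 (n + 1) < 2 ^ Nat.log 2 (n + 1) := by
  have h := Nat.lt_pow_succ_log_self (b := 2) (by norm_num) (n + 1)
  have h' := Nat.pow_log_le_self 2 (x := n + 1) (by omega)
  rw [pow_succ] at h
  omega

theorem block_add_sub (n : ℕ) :
    2 ^ Nat.log 2 (n + 1) - 1 + (n + 1 - 2 ^ Nat.log 2 (n + 1)) = n := by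
  have h' := Nat.pow_log_le_self 2 (x := n + 1) (by omega)
  have h := Nat.two_pow_pos (Nat.log 2 (n + 1))
  omega

theorem sum_eq_sum_blockPart {M : Type*} [AddCommMonoid M] (A : Finset ℕ) (u : ℕ → M) :
    ∑ n ∈ A, u n = ∑ k ∈ A.image (fun n => Nat.log 2 (n + 1)),
      ∑ j ∈ blockPart A k, u (2 ^ k - 1 + j) := by
  rw [← Finset.sum_fiberwise_of_maps_to (s := A) (g := fun n => Nat.log 2 (n + 1))
    fun n hn => Finset.mem_image.2 ⟨n, hn, rfl⟩]
  refine Finset.sum_congr rfl fun k _ => Finset.sum_nbij' (fun n => n + 1 - 2 ^ k)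
    (fun j => 2 ^ k - 1 + j) ?_ ?_ ?_ ?_ ?_
  · intro n hn
    obtain ⟨hA, rfl⟩ := Finset.mem_filter.1 hn
    rw [mem_blockPart, block_add_sub]
    exact ⟨sub_lt_two_pow_log n, hA⟩
  · intro j hj
    rw [mem_blockPart] at hj
    exact Finset.mem_filter.2 ⟨hj.2, log_two_block hj.1⟩
  · intro n hn
    obtain ⟨hA, rfl⟩ := Finset.mem_filter.1 hn
    exact block_add_sub n
  · intro j _
    have := Nat.two_pow_pos k
    omega
  · intro n hn
    obtain ⟨hA, rfl⟩ := Finset.mem_filter.1 hn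
    rw [block_add_sub]

theorem blockPart_eq_empty {A : Finset ℕ} {k : ℕ}
    (hk : k ∉ A.image (fun n => Nat.log 2 (n + 1))) : blockPart A k = ∅ := by
  refine Finset.eq_empty_of_forall_notMem fun j hj => hk ?_
  rw [mem_blockPart] at hj
  exact Finset.mem_image.2 ⟨_, hj.2, log_two_block hj.1⟩

theorem card_blockPart_le (A : Finset ℕ) (k : ℕ) : (blockPart A k).card ≤ A.card :=
  Finset.card_le_card_of_injOn (fun j => 2 ^ k - 1 + j) (fun j hj => (mem_blockPart.1 hj).2)
    fun i _ j _ h => by simpa using h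

theorem dyadicBlock_of_lt (a : ℕ → 𝕜) {k j : ℕ} (h : j < 2 ^ k) :
    dyadicBlock a k j = a (2 ^ k - 1 + j) := if_pos h

theorem dyadicBlock_of_le (a : ℕ → 𝕜) {k j : ℕ} (h : 2 ^ k ≤ j) : dyadicBlock a k j = 0 :=
  if_neg (not_lt.2 h)

theorem dyadicBlock_add (a b : ℕ → 𝕜) (k : ℕ) :
    dyadicBlock (a + b) k = dyadicBlock a k + dyadicBlock b k := by
  ext j; by_cases h : j < 2 ^ k <;> simp [dyadicBlock, h]

theorem dyadicBlock_indicator (S : Set ℕ) (a : ℕ → 𝕜) (k : ℕ) :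
    dyadicBlock (S.indicator a) k =
      Set.indicator {j | 2 ^ k - 1 + j ∈ S} (dyadicBlock a k) := by
  ext j
  by_cases h : j < 2 ^ k <;> by_cases hS : 2 ^ k - 1 + j ∈ S <;> simp [dyadicBlock, h, hS]

theorem dyadicBlock_indicator_coe (A : Finset ℕ) (a : ℕ → 𝕜) (k : ℕ) :
    dyadicBlock ((A : Set ℕ).indicator a) k =
      Set.indicator (blockPart A k : Set ℕ) (dyadicBlock a k) := by
  ext j
  by_cases h : j < 2 ^ k <;> by_cases hS : 2 ^ k - 1 + j ∈ A <;>
    simp [dyadicBlock, h, hS, blockPart, Set.indicator]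

theorem truncNorm_dyadicBlock_ne_top (hp : 1 < p) (a : ℕ → 𝕜) (k : ℕ) :
    truncNorm p (dyadicBlock a k) ≠ ⊤ :=
  truncNorm_ne_top hp fun _ h => dyadicBlock_of_le a h

theorem blockSumNorm_rpow (hp : 1 < p) (a : ℕ → 𝕜) :
    blockSumNorm p a ^ p = ∑' k, truncNorm p (dyadicBlock a k) ^ p := by
  rw [blockSumNorm, ← ENNReal.rpow_mul, one_div_mul_cancel (by positivity), ENNReal.rpow_one]

theorem blockSumNorm_le_mul (hp : 1 < p) {a b : ℕ → 𝕜} (C : ℝ≥0∞)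
    (h : ∀ k, truncNorm p (dyadicBlock a k) ≤ C * truncNorm p (dyadicBlock b k)) :
    blockSumNorm p a ≤ C * blockSumNorm p b := by
  have hp0 : 0 ≤ p := by linarith
  have h1 : blockSumNorm p a ^ p ≤ (C * blockSumNorm p b) ^ p := by
    rw [ENNReal.mul_rpow_of_nonneg _ _ hp0, blockSumNorm_rpow hp, blockSumNorm_rpow hp,
      ← ENNReal.tsum_mul_left]
    refine ENNReal.tsum_le_tsum fun k => ?_
    rw [← ENNReal.mul_rpow_of_nonneg _ _ hp0]
    exact ENNReal.rpow_le_rpow (h k) hp0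
  exact (ENNReal.rpow_le_rpow_iff (by linarith)).1 h1

theorem blockSumNorm_mono (hp : 1 < p) {a b : ℕ → 𝕜}
    (h : ∀ k, truncNorm p (dyadicBlock a k) ≤ truncNorm p (dyadicBlock b k)) :
    blockSumNorm p a ≤ blockSumNorm p b := by
  simpa using blockSumNorm_le_mul hp 1 (by simpa using h)

theorem blockSumNorm_indicator_Ici_le (hp : 1 < p) (m : ℕ) (a : ℕ → 𝕜) :
    blockSumNorm p ((Set.Ici m).indicator a) ≤ blockSumNorm p a := by
  refine blockSumNorm_mono hp fun k => ?_
  have : {j | 2 ^ k - 1 + j ∈ Set.Ici m} = Set.Ici (m - (2 ^ k - 1)) := by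
    ext j; simp only [Set.mem_Ici, Set.mem_ofPred_eq]; omega
  rw [dyadicBlock_indicator, this]
  exact truncNorm_indicator_Ici_le hp _ _

theorem blockSumNorm_indicator_Iio_le (hp : 1 < p) (m : ℕ) (a : ℕ → 𝕜) :
    blockSumNorm p ((Set.Iio m).indicator a) ≤ blockSumNorm p a := by
  refine blockSumNorm_mono hp fun k => ?_
  have : {j | 2 ^ k - 1 + j ∈ Set.Iio m} = Set.Iio (m - (2 ^ k - 1)) := by
    ext j; simp only [Set.mem_Iio, Set.mem_ofPred_eq]; omega
  rw [dyadicBlock_indicator, this]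
  exact truncNorm_indicator_Iio_le hp _ _

theorem blockSumNorm_indicator_compl_le (hp : 1 < p) {a : ℕ → 𝕜} {A : Finset ℕ}
    (hA : ∀ n ∈ A, ∀ k ∉ A, ‖a k‖ ≤ ‖a n‖) :
    blockSumNorm p ((A : Set ℕ)ᶜ.indicator a) ≤ blockSumNorm p a := by
  refine blockSumNorm_mono hp fun k => ?_
  have : dyadicBlock ((A : Set ℕ)ᶜ.indicator a) k =
      (blockPart A k : Set ℕ)ᶜ.indicator (dyadicBlock a k) := by
    ext j
    by_cases h : j < 2 ^ k <;> by_cases hS : 2 ^ k - 1 + j ∈ A <;>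
      simp [dyadicBlock, h, hS, blockPart, Set.indicator]
  rw [this]
  refine truncNorm_indicator_compl_le hp fun n hn j hj => ?_
  rw [mem_blockPart] at hn hj
  rw [dyadicBlock_of_lt a hn.1]
  by_cases h : j < 2 ^ k
  · rw [dyadicBlock_of_lt a h]
    exact hA _ hn.2 _ fun h' => hj ⟨h, h'⟩
  · rw [dyadicBlock_of_le a (not_lt.1 h), norm_zero]
    exact norm_nonneg _

theorem blockSumNorm_indicator_le (hp : 1 < p) (a : ℕ → 𝕜) {r : ℕ} {A : Finset ℕ}
    (hA : A.card ≤ 2 ^ r) :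
    blockSumNorm p ((A : Set ℕ).indicator a) ≤ (r + 2) * blockSumNorm p a := by
  refine blockSumNorm_le_mul hp _ fun k => ?_
  rw [dyadicBlock_indicator_coe]
  exact truncNorm_indicator_le hp (truncNorm_dyadicBlock_ne_top hp a k)
    ((card_blockPart_le A k).trans hA)

theorem blockSumNorm_le_card_rpow (hp : 1 < p) {a : ℕ → 𝕜} {A : Finset ℕ}
    (hA : ∀ n ∈ A, ‖a n‖ ≤ 1) (h0 : ∀ n ∉ A, a n = 0) :
    blockSumNorm p a ≤ (A.card : ℝ≥0∞) ^ (1 / p) := by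
  refine ENNReal.rpow_le_rpow ?_ (by positivity)
  have hcard : (A.card : ℝ≥0∞) = ∑' k, ((blockPart A k).card : ℝ≥0∞) := by
    rw [tsum_eq_sum (s := A.image (fun n => Nat.log 2 (n + 1)))
      fun k hk => by simp [blockPart_eq_empty hk]]
    have := sum_eq_sum_blockPart A fun _ => (1 : ℝ≥0∞)
    simpa using this
  rw [hcard]
  refine ENNReal.tsum_le_tsum fun k => ?_
  have h := truncNorm_le_card_rpow hp (f := dyadicBlock a k) (A := blockPart A k)
    (fun j hj => by
      rw [mem_blockPart] at hj
      rw [dyadicBlock_of_lt a hj.1]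
      exact hA _ hj.2)
    (fun j hj => by
      by_cases h : j < 2 ^ k
      · rw [dyadicBlock_of_lt a h]
        exact h0 _ fun h' => hj (mem_blockPart.2 ⟨h, h'⟩)
      · exact dyadicBlock_of_le a (not_lt.1 h))
  refine (ENNReal.rpow_le_rpow h (by linarith)).trans_eq ?_
  rw [← ENNReal.rpow_mul, one_div_mul_cancel (by positivity), ENNReal.rpow_one]

theorem sum_enorm_le_card_rpow_mul (hp : 1 < p) (a : ℕ → 𝕜) (A : Finset ℕ) :
    ∑ n ∈ A, ‖a n‖ₑ ≤ (A.card : ℝ≥0∞) ^ (1 - 1 / p) * blockSumNorm p a := by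
  have hs1 : 1 / p < 1 := by rw [div_lt_one] <;> linarith
  have hq : 0 < 1 - 1 / p := by linarith
  rw [sum_eq_sum_blockPart A]
  set K := A.image (fun n => Nat.log 2 (n + 1)) with hK
  have h1 : ∀ k ∈ K, ∑ j ∈ blockPart A k, ‖a (2 ^ k - 1 + j)‖ₑ ≤
      ((blockPart A k).card : ℝ≥0∞) ^ (1 - 1 / p) * truncNorm p (dyadicBlock a k) := by
    intro k _
    have hf := truncNorm_dyadicBlock_ne_top hp a k
    have h := ENNReal.ofReal_le_ofReal (sum_norm_le_card_rpow_mul hf (blockPart A k))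
    rw [ENNReal.ofReal_mul (by positivity), ENNReal.ofReal_toReal hf,
      ← ENNReal.ofReal_rpow_of_nonneg (Nat.cast_nonneg _) hq.le, ENNReal.ofReal_natCast,
      ENNReal.ofReal_sum_of_nonneg fun _ _ => norm_nonneg _] at h
    refine le_of_eq_of_le (Finset.sum_congr rfl fun j hj => ?_) h
    rw [dyadicBlock_of_lt a (mem_blockPart.1 hj).1, ofReal_norm]
  have hpq : (1 / (1 - 1 / p)).HolderConjugate p := by
    rw [Real.holderConjugate_comm, Real.holderConjugate_iff]
    exact ⟨hp, by field_simp; ring⟩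
  refine (Finset.sum_le_sum h1).trans ((ENNReal.inner_le_Lp_mul_Lq K _ _ hpq).trans ?_)
  rw [one_div_one_div]
  gcongr ?_ ^ _ * ?_
  · have := sum_eq_sum_blockPart A fun _ => (1 : ℝ≥0∞)
    rw [← hK] at this
    simp only [Finset.sum_const, nsmul_eq_mul, mul_one] at this
    rw [this]
    refine (Finset.sum_congr rfl fun k _ => ?_).le
    rw [← ENNReal.rpow_mul, mul_one_div_cancel hq.ne', ENNReal.rpow_one]
  · exact ENNReal.rpow_le_rpow (ENNReal.sum_le_tsum K) (by positivity)

theorem enorm_le_blockSumNorm (hp : 1 < p) (a : ℕ → 𝕜) (n : ℕ) : ‖a n‖ₑ ≤ blockSumNorm p a := by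
  simpa using sum_enorm_le_card_rpow_mul hp a {n}

/-- The norm is `p`-additive over sequences supported in disjoint sets of blocks. -/
theorem blockSumNorm_add_rpow (hp : 1 < p) {a b : ℕ → 𝕜} (K : ℕ)
    (ha : ∀ n, 2 ^ K - 1 ≤ n → a n = 0) (hb : ∀ n, n < 2 ^ K - 1 → b n = 0) :
    blockSumNorm p (a + b) ^ p = blockSumNorm p a ^ p + blockSumNorm p b ^ p := by
  have hp0 : 0 < p := by linarith
  rw [blockSumNorm_rpow hp, blockSumNorm_rpow hp, blockSumNorm_rpow hp, ← ENNReal.tsum_add]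
  refine tsum_congr fun k => ?_
  rw [dyadicBlock_add]
  rcases lt_or_ge k K with h | h
  · have : dyadicBlock b k = 0 := by
      ext j
      by_cases hj : j < 2 ^ k
      · rw [dyadicBlock_of_lt b hj]
        have : 2 ^ (k + 1) ≤ 2 ^ K := Nat.pow_le_pow_right (by norm_num) h
        rw [pow_succ] at this
        exact hb _ (by omega)
      · exact dyadicBlock_of_le b (not_lt.1 hj)
    rw [this, truncNorm_zero, ENNReal.zero_rpow_of_pos hp0, add_zero, add_zero]
  · have : dyadicBlock a k = 0 := by
      ext j
      by_cases hj : j < 2 ^ k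
      · rw [dyadicBlock_of_lt a hj]
        have : 2 ^ K ≤ 2 ^ k := Nat.pow_le_pow_right (by norm_num) h
        exact ha _ (by omega)
      · exact dyadicBlock_of_le a (not_lt.1 hj)
    rw [this, truncNorm_zero, ENNReal.zero_rpow_of_pos hp0, zero_add, zero_add]

/-- The sequence `f`, placed in the `K`-th dyadic block. -/
def placeBlock (K : ℕ) (f : ℕ → 𝕜) (n : ℕ) : 𝕜 :=
  if Nat.log 2 (n + 1) = K then f (n + 1 - 2 ^ K) else 0

theorem placeBlock_eq_zero {K : ℕ} {f : ℕ → 𝕜} {n : ℕ} (hn : 2 ^ (K + 1) - 1 ≤ n) :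
    placeBlock K f n = 0 := by
  refine if_neg ?_
  rintro rfl
  have h := Nat.lt_pow_succ_log_self (b := 2) (by norm_num) (n + 1)
  omega

theorem blockSumNorm_placeBlock (hp : 1 < p) {K : ℕ} {f : ℕ → 𝕜}
    (hf : ∀ j, 2 ^ K ≤ j → f j = 0) : blockSumNorm p (placeBlock K f) = truncNorm p f := by
  have h1 : dyadicBlock (placeBlock K f) K = f := by
    ext j
    by_cases hj : j < 2 ^ K
    · rw [dyadicBlock_of_lt _ hj, placeBlock, if_pos (log_two_block hj)]
      have := Nat.two_pow_pos K
      congr 1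
      omega
    · rw [dyadicBlock_of_le _ (not_lt.1 hj), hf j (not_lt.1 hj)]
  have h2 : ∀ k, k ≠ K → dyadicBlock (placeBlock K f) k = 0 := by
    intro k hk
    ext j
    by_cases hj : j < 2 ^ k
    · rw [dyadicBlock_of_lt _ hj, placeBlock, if_neg (by rwa [log_two_block hj])]
      rfl
    · exact dyadicBlock_of_le _ (not_lt.1 hj)
  rw [blockSumNorm, tsum_eq_single K fun k hk => by
    rw [h2 k hk, truncNorm_zero, ENNReal.zero_rpow_of_pos (by linarith)], h1,
    ← ENNReal.rpow_mul, mul_one_div_cancel (by positivity), ENNReal.rpow_one]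

theorem indicator_placeBlock (K : ℕ) (S : Set ℕ) (f : ℕ → 𝕜) :
    Set.indicator {n | n + 1 - 2 ^ K ∈ S} (placeBlock K f) = placeBlock K (S.indicator f) := by
  ext n
  by_cases h : n + 1 - 2 ^ K ∈ S <;> simp [placeBlock, h]

end BlockSumNorm

section SequenceLimits

variable {𝕜 : Type*} [RCLike 𝕜] {p : ℝ}

theorem blockSumNorm_le_of_forall_indicator_Iio_le (hp : 1 < p) {a : ℕ → 𝕜} {C : ℝ≥0∞}
    (h : ∀ N, blockSumNorm p ((Set.Iio N).indicator a) ≤ C) : blockSumNorm p a ≤ C := by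
  have hp0 : 0 < p := by linarith
  refine (ENNReal.rpow_le_rpow_iff hp0).1 ?_
  rw [blockSumNorm_rpow hp, ENNReal.tsum_eq_iSup_nat]
  refine iSup_le fun K => ?_
  refine le_trans ?_ (ENNReal.rpow_le_rpow (h (2 ^ K - 1)) hp0.le)
  rw [blockSumNorm_rpow hp]
  refine le_of_eq_of_le (Finset.sum_congr rfl fun k hk => ?_) (ENNReal.sum_le_tsum (Finset.range K))
  congr 2
  ext j
  by_cases hj : j < 2 ^ k
  · rw [dyadicBlock_of_lt _ hj, dyadicBlock_of_lt _ hj, Set.indicator_of_mem]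
    have : 2 ^ (k + 1) ≤ 2 ^ K := Nat.pow_le_pow_right (by norm_num) (Finset.mem_range.1 hk)
    rw [pow_succ] at this
    rw [Set.mem_Iio]
    omega
  · rw [dyadicBlock_of_le _ (not_lt.1 hj), dyadicBlock_of_le _ (not_lt.1 hj)]

theorem antitone_blockSumNorm_indicator_Ici (hp : 1 < p) (a : ℕ → 𝕜) :
    Antitone fun N => blockSumNorm p ((Set.Ici N).indicator a) := by
  intro M N h
  have : (Set.Ici N).indicator a = (Set.Ici N).indicator ((Set.Ici M).indicator a) := by
    rw [Set.indicator_indicator, Set.inter_eq_left.2 (Set.Ici_subset_Ici.2 h)]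
  simp only
  rw [this]
  exact blockSumNorm_indicator_Ici_le hp N _

theorem tendsto_blockSumNorm_indicator_Ici (hp : 1 < p) {a : ℕ → 𝕜} (ha : blockSumNorm p a ≠ ⊤) :
    Filter.Tendsto (fun N => blockSumNorm p ((Set.Ici N).indicator a)) Filter.atTop (nhds 0) := by
  have hp0 : 0 < p := by linarith
  have hsum : ∑' k, truncNorm p (dyadicBlock a k) ^ p ≠ ⊤ := by
    rw [← blockSumNorm_rpow hp]
    exact ENNReal.rpow_ne_top_of_nonneg hp0.le ha
  have htail : ∀ K, blockSumNorm p ((Set.Ici (2 ^ K - 1)).indicator a) ^ p =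
      ∑' k, truncNorm p (dyadicBlock a (k + K)) ^ p := by
    intro K
    have hsplit := Summable.sum_add_tsum_nat_add' (k := K) (ENNReal.summable (f := fun k =>
      truncNorm p (dyadicBlock ((Set.Ici (2 ^ K - 1)).indicator a) (k + K)) ^ p))
      (f := fun k => truncNorm p (dyadicBlock ((Set.Ici (2 ^ K - 1)).indicator a) k) ^ p)
    rw [blockSumNorm_rpow hp, ← hsplit, Finset.sum_eq_zero fun k hk => ?_, zero_add]
    · refine tsum_congr fun k => ?_
      congr 2
      ext j
      by_cases hj : j < 2 ^ (k + K)
      · rw [dyadicBlock_of_lt _ hj, dyadicBlock_of_lt _ hj, Set.indicator_of_mem]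
        have : 2 ^ K ≤ 2 ^ (k + K) := Nat.pow_le_pow_right (by norm_num) (by omega)
        rw [Set.mem_Ici]
        omega
      · rw [dyadicBlock_of_le _ (not_lt.1 hj), dyadicBlock_of_le _ (not_lt.1 hj)]
    · have : dyadicBlock ((Set.Ici (2 ^ K - 1)).indicator a) k = 0 := by
        ext j
        by_cases hj : j < 2 ^ k
        · rw [dyadicBlock_of_lt _ hj, Set.indicator_of_notMem, Pi.zero_apply]
          have : 2 ^ (k + 1) ≤ 2 ^ K :=
            Nat.pow_le_pow_right (by norm_num) (Finset.mem_range.1 hk)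
          rw [pow_succ] at this
          rw [Set.mem_Ici]
          omega
        · exact dyadicBlock_of_le _ (not_lt.1 hj)
      rw [this, truncNorm_zero, ENNReal.zero_rpow_of_pos hp0]
  have h := ENNReal.tendsto_sum_nat_add _ hsum
  rw [ENNReal.tendsto_atTop_zero] at h ⊢
  intro ε hε
  obtain ⟨K, hK⟩ := h (ε ^ p) (ENNReal.rpow_pos_of_nonneg hε hp0.le)
  refine ⟨2 ^ K - 1, fun N hN => (antitone_blockSumNorm_indicator_Ici hp a hN).trans ?_⟩
  refine (ENNReal.rpow_le_rpow_iff hp0).1 ?_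
  rw [htail]
  exact hK K le_rfl

end SequenceLimits

section TruncSpace

/-- The sequences supported on the first `2 ^ k` indices. -/
def truncSubmodule (𝕜 : Type*) [RCLike 𝕜] (k : ℕ) : Submodule 𝕜 (ℕ → 𝕜) where
  carrier := {f | ∀ j, 2 ^ k ≤ j → f j = 0}
  add_mem' hf hg j hj := by simp [hf j hj, hg j hj]
  zero_mem' _ _ := rfl
  smul_mem' c f hf j hj := by simp [hf j hj]

/-- The space of sequences supported on the first `2 ^ k` indices, with the norm `truncNorm p`. -/
def TruncSpace (𝕜 : Type*) [RCLike 𝕜] (_ : ℝ) (k : ℕ) : Type _ := truncSubmodule 𝕜 k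

namespace TruncSpace

variable {𝕜 : Type*} [RCLike 𝕜] {p : ℝ} {k : ℕ}

instance : AddCommGroup (TruncSpace 𝕜 p k) := inferInstanceAs (AddCommGroup (truncSubmodule 𝕜 k))

instance : Module 𝕜 (TruncSpace 𝕜 p k) := inferInstanceAs (Module 𝕜 (truncSubmodule 𝕜 k))

/-- The underlying sequence. -/
def toSeq : TruncSpace 𝕜 p k →ₗ[𝕜] (ℕ → 𝕜) := (truncSubmodule 𝕜 k).subtype

theorem toSeq_injective : Function.Injective (toSeq : TruncSpace 𝕜 p k → ℕ → 𝕜) :=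
  Subtype.val_injective

theorem toSeq_eq_zero (f : TruncSpace 𝕜 p k) {j : ℕ} (hj : 2 ^ k ≤ j) : toSeq f j = 0 :=
  Subtype.property (p := fun f : ℕ → 𝕜 => f ∈ truncSubmodule 𝕜 k) f j hj

/-- The element with the given underlying sequence. -/
def ofSeq (f : ℕ → 𝕜) (hf : ∀ j, 2 ^ k ≤ j → f j = 0) : TruncSpace 𝕜 p k :=
  (⟨f, hf⟩ : truncSubmodule 𝕜 k)

noncomputable instance : Norm (TruncSpace 𝕜 p k) := ⟨fun f => (truncNorm p (toSeq f)).toReal⟩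

theorem norm_def (f : TruncSpace 𝕜 p k) : ‖f‖ = (truncNorm p (toSeq f)).toReal := rfl

theorem truncNorm_toSeq_ne_top (hp : 1 < p) (f : TruncSpace 𝕜 p k) :
    truncNorm p (toSeq f) ≠ ⊤ := truncNorm_ne_top hp fun _ hj => toSeq_eq_zero f hj

theorem core (hp : 1 < p) : NormedSpace.Core 𝕜 (TruncSpace 𝕜 p k) where
  norm_nonneg _ := ENNReal.toReal_nonneg
  norm_smul c f := by
    rw [norm_def, norm_def, map_smul, truncNorm_smul, ENNReal.toReal_mul, toReal_enorm]
  norm_triangle f g := by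
    rw [norm_def, norm_def, norm_def, map_add, ← ENNReal.toReal_add
      (truncNorm_toSeq_ne_top hp f) (truncNorm_toSeq_ne_top hp g)]
    exact ENNReal.toReal_mono (ENNReal.add_ne_top.2
      ⟨truncNorm_toSeq_ne_top hp f, truncNorm_toSeq_ne_top hp g⟩) (truncNorm_add_le _ _)
  norm_eq_zero_iff f := by
    constructor
    · intro h
      rw [norm_def, ENNReal.toReal_eq_zero_iff] at h
      have h0 := h.resolve_right (truncNorm_toSeq_ne_top hp f)
      refine toSeq_injective (funext fun n => ?_)
      have := enorm_le_truncNorm (p := p) (toSeq f) n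
      rw [h0, nonpos_iff_eq_zero, enorm_eq_zero] at this
      rw [this, map_zero, Pi.zero_apply]
    · rintro rfl
      rw [norm_def, map_zero, truncNorm_zero, ENNReal.toReal_zero]

variable [Fact (1 < p)]

noncomputable instance : NormedAddCommGroup (TruncSpace 𝕜 p k) :=
  NormedAddCommGroup.ofCore (core Fact.out)

noncomputable instance : NormedSpace 𝕜 (TruncSpace 𝕜 p k) := NormedSpace.ofCore (core Fact.out)

instance : FiniteDimensional 𝕜 (TruncSpace 𝕜 p k) := by
  refine FiniteDimensional.of_injective
    ((LinearMap.funLeft 𝕜 𝕜 (fun i : Fin (2 ^ k) => (i : ℕ))).comp toSeq) fun f g h => ?_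
  refine toSeq_injective (funext fun j => ?_)
  by_cases hj : j < 2 ^ k
  · exact congrFun h ⟨j, hj⟩
  · rw [toSeq_eq_zero f (not_lt.1 hj), toSeq_eq_zero g (not_lt.1 hj)]

instance : CompleteSpace (TruncSpace 𝕜 p k) := FiniteDimensional.complete 𝕜 _

theorem enorm_eq (f : TruncSpace 𝕜 p k) : ‖f‖ₑ = truncNorm p (toSeq f) := by
  rw [← ofReal_norm]
  exact ENNReal.ofReal_toReal (truncNorm_toSeq_ne_top Fact.out f)

end TruncSpace

/-- The space of sequences with finite `blockSumNorm`, as a Banach space. -/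
theorem exists_blockSum_space (𝕜 : Type u) [RCLike 𝕜] (p : ℝ) (hp : 1 < p) :
    ∃ (X : Type u) (_ : NormedAddCommGroup X) (_ : NormedSpace 𝕜 X) (_ : CompleteSpace X)
      (T : X →ₗ[𝕜] (ℕ → 𝕜)), (∀ x, ‖x‖ₑ = blockSumNorm p (T x)) ∧
        ∀ a, blockSumNorm p a ≠ ⊤ → ∃ x, T x = a := by
  have hp0 : 0 < p := by linarith
  have : Fact (1 < p) := ⟨hp⟩
  have : Fact (1 ≤ ENNReal.ofReal p) := ⟨by
    rw [← ENNReal.ofReal_one]; exact ENNReal.ofReal_le_ofReal hp.le⟩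
  have hpr : (ENNReal.ofReal p).toReal = p := ENNReal.toReal_ofReal hp0.le
  have hprpos : 0 < (ENNReal.ofReal p).toReal := by rwa [hpr]
  let T : lp (fun k => TruncSpace 𝕜 p k) (ENNReal.ofReal p) →ₗ[𝕜] (ℕ → 𝕜) :=
    { toFun := fun x n => TruncSpace.toSeq (x (Nat.log 2 (n + 1))) (n + 1 - 2 ^ Nat.log 2 (n + 1))
      map_add' := fun x y => by ext n; simp
      map_smul' := fun c x => by ext n; simp }
  have hblock : ∀ x k, dyadicBlock (T x) k = TruncSpace.toSeq (x k) := by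
    intro x k
    ext j
    by_cases hj : j < 2 ^ k
    · rw [dyadicBlock_of_lt _ hj]
      change TruncSpace.toSeq (x (Nat.log 2 (2 ^ k - 1 + j + 1)))
        (2 ^ k - 1 + j + 1 - 2 ^ Nat.log 2 (2 ^ k - 1 + j + 1)) = _
      have hj' : 2 ^ k - 1 + j + 1 - 2 ^ k = j := by
        have := Nat.two_pow_pos k
        omega
      rw [log_two_block hj, hj']
    · rw [dyadicBlock_of_le _ (not_lt.1 hj), TruncSpace.toSeq_eq_zero _ (not_lt.1 hj)]
  refine ⟨lp (fun k => TruncSpace 𝕜 p k) (ENNReal.ofReal p), inferInstance, inferInstance,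
    inferInstance, T, fun x => ?_, fun a ha => ?_⟩
  · have hs : Summable fun k => ‖x k‖ ^ p := by
      simpa [hpr] using (lp.memℓp x).summable hprpos
    rw [← ofReal_norm, lp.norm_eq_tsum_rpow hprpos, hpr,
      ← ENNReal.ofReal_rpow_of_nonneg (tsum_nonneg fun k => by positivity) (by positivity),
      ENNReal.ofReal_tsum_of_nonneg (fun k => by positivity) hs, blockSumNorm]
    congr 1
    refine tsum_congr fun k => ?_
    rw [hblock, ← TruncSpace.enorm_eq, ← ENNReal.ofReal_rpow_of_nonneg (norm_nonneg _) hp0.le,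
      ofReal_norm]
  · have hmem : Memℓp (fun k => (TruncSpace.ofSeq (dyadicBlock a k)
        (fun _ h => dyadicBlock_of_le a h) : TruncSpace 𝕜 p k)) (ENNReal.ofReal p) := by
      refine memℓp_gen ?_
      have hsum : ∑' k, truncNorm p (dyadicBlock a k) ^ p ≠ ⊤ := by
        rw [← blockSumNorm_rpow hp]
        exact ENNReal.rpow_ne_top_of_nonneg hp0.le ha
      refine (ENNReal.summable_toReal hsum).congr fun k => ?_
      rw [hpr, ← ENNReal.toReal_rpow]
      rfl
    refine ⟨⟨_, hmem⟩, funext fun n => ?_⟩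
    change dyadicBlock a (Nat.log 2 (n + 1)) (n + 1 - 2 ^ Nat.log 2 (n + 1)) = a n
    rw [dyadicBlock_of_lt _ (sub_lt_two_pow_log n), block_add_sub]

end TruncSpace

section BlockSumBasis

variable {𝕜 : Type*} [RCLike 𝕜] {p : ℝ} {X : Type*} [NormedAddCommGroup X] [NormedSpace 𝕜 X]

theorem blockSumNorm_single_le_one (hp : 1 < p) (j : ℕ) :
    blockSumNorm p (Pi.single j 1 : ℕ → 𝕜) ≤ 1 := by
  have h := blockSumNorm_le_card_rpow hp (a := (Pi.single j 1 : ℕ → 𝕜)) (A := {j})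
    (fun n hn => by simp [Finset.mem_singleton.1 hn]) fun n hn => by
      rw [Finset.mem_singleton] at hn; simp [hn]
  simpa using h

/-- A norm given by `blockSumNorm` through coordinates makes the coordinates those of a basis. -/
theorem exists_blockSum_basis (hp : 1 < p) (T : X →ₗ[𝕜] (ℕ → 𝕜))
    (hT : ∀ x, ‖x‖ₑ = blockSumNorm p (T x)) (hsurj : ∀ a, blockSumNorm p a ≠ ⊤ → ∃ x, T x = a) :
    ∃ b : SchauderBasis 𝕜 X, ∀ n x, b.coord n x = T x n := by
  choose e he using fun j : ℕ => hsurj (Pi.single j 1)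
    (ne_top_of_le_ne_top ENNReal.one_ne_top (blockSumNorm_single_le_one hp j))
  have hTsum : ∀ (x : X) (N : ℕ), T (∑ n ∈ Finset.range N, T x n • e n) =
      (Set.Iio N).indicator (T x) := by
    intro x N
    ext i
    rw [map_sum, Finset.sum_apply]
    simp [he, Pi.single_apply, Set.indicator]
  refine ⟨⟨e, fun n => ((LinearMap.proj n).comp T).mkContinuous 1 fun x => ?_,
    fun i j => ?_, fun x => ?_⟩, fun n x => rfl⟩
  · have h := enorm_le_blockSumNorm hp (T x) n
    rw [← hT] at h
    rw [one_mul]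
    exact enorm_le_iff_norm_le.1 h
  · simp [he, Pi.single_apply]
  · rw [HasSum, SummationFilter.conditional_filter_eq_map_range, Filter.tendsto_map'_iff,
      tendsto_iff_edist_tendsto_0]
    refine (tendsto_blockSumNorm_indicator_Ici hp (a := T x) (by simp [← hT])).congr fun N => ?_
    simp only [Function.comp_apply, LinearMap.mkContinuous_apply, LinearMap.comp_apply,
      LinearMap.proj_apply]
    rw [edist_comm, edist_eq_enorm_sub, hT, map_sub, hTsum]
    congr 1
    ext n
    by_cases h : n < N
    · simp [h]
    · simp [h, not_lt.1 h]

namespace SchauderBasis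

theorem coord_sum (b : SchauderBasis 𝕜 X) (A : Finset ℕ) (a : ℕ → 𝕜) :
    (fun i => b.coord i (∑ n ∈ A, a n • b n)) = (A : Set ℕ).indicator a := by
  ext i
  simp [b.ortho, Pi.single_apply, Set.indicator]

theorem coord_coordProj (b : SchauderBasis 𝕜 X) (A : Finset ℕ) (x : X) :
    (fun i => b.coord i (coordProj b A x)) =
      (A : Set ℕ).indicator fun n => b.coord n x := by
  rw [coordProj, GeneralSchauderBasis.proj_apply, coord_sum]

theorem coord_sub_coordProj (b : SchauderBasis 𝕜 X) (A : Finset ℕ) (x : X) :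
    (fun i => b.coord i (x - coordProj b A x)) =
      (A : Set ℕ)ᶜ.indicator fun n => b.coord n x := by
  rw [Set.indicator_compl, ← coord_coordProj]
  ext i
  simp only [map_sub, Pi.sub_apply]

theorem uncondParamTilde_le (b : SchauderBasis 𝕜 X) (m : ℕ) :
    uncondParamTilde b m ≤ uncondParam b m := by
  refine iSup₂_le fun A x => iSup₂_le fun hx hsupp => ?_
  have h1 : coordProj b A x =
      coordProj b (A ∩ Finset.range m) x := by
    simp only [coordProj, GeneralSchauderBasis.proj_apply]
    refine (Finset.sum_subset Finset.inter_subset_left fun n hn hn' => ?_).symm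
    rw [hsupp n (by simpa [hn] using hn'), zero_smul]
  have h2 : (A ∩ Finset.range m).card ≤ m :=
    (Finset.card_le_card Finset.inter_subset_right).trans_eq (Finset.card_range m)
  have hx' : ‖x‖ₑ ≤ 1 := by
    rw [← ofReal_norm, ← ENNReal.ofReal_one]; exact ENNReal.ofReal_le_ofReal hx
  rw [h1]
  refine (ContinuousLinearMap.le_opENorm _ _).trans ((mul_le_of_le_one_right' hx').trans ?_)
  exact le_iSup₂_of_le (f := fun (A : Finset ℕ) (_ : A.card ≤ m) =>
    ‖coordProj b A‖ₑ) _ h2 le_rfl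

/-- A functional whose norm on tails is not eventually at most `c` attains more than `c` at some
finitely supported unit vector of any given tail. -/
theorem exists_unit_vector (b : SchauderBasis 𝕜 X) (g : StrongDual 𝕜 X) {c : ℝ}
    (hc : 0 ≤ c) {M : ℕ} {x : X} (hx : ∀ n < M, b.coord n x = 0) (hgx : c * ‖x‖ < ‖g x‖) :
    ∃ (u : X) (N : ℕ) (r : ℝ), (∀ n < M, b.coord n u = 0) ∧ (∀ n, N ≤ n → b.coord n u = 0) ∧
      ‖u‖ = 1 ∧ c < r ∧ g u = (r : 𝕜) := by
  have ht := SchauderBasis.tendsto_proj b x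
  have hopen : IsOpen {y : X | c * ‖y‖ < ‖g y‖} :=
    isOpen_lt (by fun_prop) (by fun_prop)
  obtain ⟨N, hN⟩ := (ht.eventually (hopen.mem_nhds hgx)).exists
  set y := SchauderBasis.proj b N x with hy
  have hcoord : ∀ n, b.coord n y = (Set.Iio N).indicator (fun n => b.coord n x) n := fun n => by
    have := congrFun (coord_coordProj b (Finset.range N) x) n
    rwa [Finset.coe_range] at this
  have hgy : c * ‖y‖ < ‖g y‖ := hN
  have hgpos : 0 < ‖g y‖ := (mul_nonneg hc (norm_nonneg y)).trans_lt hgy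
  have hypos : 0 < ‖y‖ := by
    rw [norm_pos_iff]; rintro h; rw [h, map_zero, norm_zero] at hgpos; exact lt_irrefl _ hgpos
  set θ : 𝕜 := ((‖g y‖ / ‖y‖ : ℝ) : 𝕜) / g y with hθ
  have hg0 : g y ≠ 0 := norm_pos_iff.1 hgpos
  have hθn : ‖θ‖ = ‖y‖⁻¹ := by
    rw [hθ, norm_div, RCLike.norm_ofReal, abs_of_nonneg (by positivity)]
    field_simp
  refine ⟨θ • y, N, ‖g y‖ / ‖y‖, fun n hn => ?_, fun n hn => ?_, ?_, ?_, ?_⟩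
  · rw [map_smul, hcoord, Set.indicator_apply, hx n hn, ite_self, smul_zero]
  · rw [map_smul, hcoord, Set.indicator_of_notMem (by simpa using hn), smul_zero]
  · rw [norm_smul, hθn, inv_mul_cancel₀ hypos.ne']
  · rwa [lt_div_iff₀ hypos]
  · rw [map_smul, smul_eq_mul, hθ, div_mul_cancel₀ _ hg0]

end SchauderBasis

/-- A basis whose space is the space of all sequences with finite `blockSumNorm`. -/
structure IsBlockSumBasis (p : ℝ) (b : SchauderBasis 𝕜 X) : Prop where
  enorm_eq (x : X) : ‖x‖ₑ = blockSumNorm p fun n => b.coord n x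
  exists_coord_eq (a : ℕ → 𝕜) (ha : blockSumNorm p a ≠ ⊤) : ∃ x, ∀ n, b.coord n x = a n

namespace IsBlockSumBasis

open SchauderBasis

variable {b : SchauderBasis 𝕜 X}

theorem norm_le_norm (hb : IsBlockSumBasis p b) {x y : X}
    (h : blockSumNorm p (fun n => b.coord n x) ≤ blockSumNorm p fun n => b.coord n y) :
    ‖x‖ ≤ ‖y‖ := by
  rw [← hb.enorm_eq, ← hb.enorm_eq] at h
  exact enorm_le_iff_norm_le.1 h

theorem norm_coordProj_range_apply_le (hp : 1 < p) (hb : IsBlockSumBasis p b) (N : ℕ) (x : X) :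
    ‖SchauderBasis.coordProj b (Finset.range N) x‖ ≤ ‖x‖ := by
  refine hb.norm_le_norm ?_
  rw [coord_coordProj, Finset.coe_range]
  exact blockSumNorm_indicator_Iio_le hp N _

theorem isBimonotone (hp : 1 < p) (hb : IsBlockSumBasis p b) : SchauderBasis.IsBimonotone b := by
  constructor
  · intro m n
    refine ContinuousLinearMap.opNorm_le_bound _ zero_le_one fun x => ?_
    rw [one_mul]
    refine hb.norm_le_norm ?_
    rw [coord_coordProj, Finset.coe_Ico, ← Set.Ici_inter_Iio, ← Set.indicator_indicator]
    exact (blockSumNorm_indicator_Ici_le hp m _).trans (blockSumNorm_indicator_Iio_le hp n _)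
  · intro m
    refine ContinuousLinearMap.opNorm_le_bound _ zero_le_one fun x => ?_
    rw [one_mul]
    refine hb.norm_le_norm ?_
    rw [_root_.sub_apply, ContinuousLinearMap.id_apply, coord_sub_coordProj,
      Finset.coe_range, Set.compl_Iio]
    exact blockSumNorm_indicator_Ici_le hp m _

theorem isOneSuppressionQuasiGreedy (hp : 1 < p) (hb : IsBlockSumBasis p b) :
    SchauderBasis.IsOneSuppressionQuasiGreedy b := by
  intro x A hA
  refine hb.norm_le_norm ?_
  rw [coord_sub_coordProj]
  exact blockSumNorm_indicator_compl_le hp hA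

theorem fundFun_basis_le (hp : 1 < p) (hb : IsBlockSumBasis p b) (m : ℕ) :
    SchauderBasis.fundFun 𝕜 (fun n => b n) m ≤ (m : ℝ≥0∞) ^ (1 / p) := by
  refine iSup₂_le fun A hA => iSup₂_le fun ε hε => ?_
  rw [hb.enorm_eq, coord_sum]
  refine (blockSumNorm_le_card_rpow hp (A := A) (fun n hn => ?_) fun n hn => ?_).trans
    (ENNReal.rpow_le_rpow (by exact_mod_cast hA) (by positivity))
  · simp [hn, hε]
  · simp [hn]

theorem fundFun_coord_le (hp : 1 < p) (hb : IsBlockSumBasis p b) (m : ℕ) :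
    SchauderBasis.fundFun 𝕜 (fun n => b.coord n) m ≤ (m : ℝ≥0∞) ^ (1 - 1 / p) := by
  have hs1 : 1 / p < 1 := by rw [div_lt_one] <;> linarith
  refine iSup₂_le fun A hA => iSup₂_le fun ε hε => ?_
  refine ContinuousLinearMap.opENorm_le_bound _ fun x => ?_
  have h1 : ‖(∑ n ∈ A, ε n • b.coord n) x‖ₑ ≤ ∑ n ∈ A, ‖b.coord n x‖ₑ := by
    rw [_root_.sum_apply]
    refine (enorm_sum_le _ _).trans (Finset.sum_le_sum fun n _ => ?_)
    have : ‖ε n‖ₑ = 1 := by rw [← ofReal_norm, hε, ENNReal.ofReal_one]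
    rw [_root_.smul_apply, enorm_smul, this, one_mul]
  refine h1.trans ((sum_enorm_le_card_rpow_mul hp (fun n => b.coord n x) A).trans ?_)
  rw [← hb.enorm_eq]
  gcongr

theorem isIsometricallyBidemocratic (hp : 1 < p) (hb : IsBlockSumBasis p b) :
    SchauderBasis.IsIsometricallyBidemocratic b := by
  intro m hm
  refine (mul_le_mul' (hb.fundFun_basis_le hp m) (hb.fundFun_coord_le hp m)).trans_eq ?_
  rw [← ENNReal.rpow_add _ _ (by exact_mod_cast (by omega : m ≠ 0)) (ENNReal.natCast_ne_top m)]
  simp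

theorem uncondParam_le (hp : 1 < p) (hb : IsBlockSumBasis p b) {m r : ℕ} (hm : m ≤ 2 ^ r) :
    SchauderBasis.uncondParam b m ≤ r + 2 := by
  refine iSup₂_le fun A hA => ContinuousLinearMap.opENorm_le_bound _ fun x => ?_
  rw [hb.enorm_eq, hb.enorm_eq x, coord_coordProj]
  exact blockSumNorm_indicator_le hp _ (hA.trans hm)

theorem uncondParam_le_log (hp : 1 < p) (hb : IsBlockSumBasis p b) {m : ℕ} (hm : 1 ≤ m) :
    SchauderBasis.uncondParam b m ≤ (8 : ℝ≥0) * ENNReal.ofReal (Real.log (1 + (m : ℝ))) := by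
  have hlt := Nat.lt_pow_succ_log_self (b := 2) (by norm_num) m
  have hle := Nat.pow_log_le_self 2 (x := m) (by omega)
  refine (hb.uncondParam_le hp hlt.le).trans ?_
  set L := Nat.log 2 m
  have hmr : (1 : ℝ) ≤ m := by exact_mod_cast hm
  have h1 : (L : ℝ) * Real.log 2 ≤ Real.log (1 + (m : ℝ)) := by
    rw [← Real.log_pow]
    refine Real.log_le_log (by positivity) ?_
    have : ((2 : ℝ) ^ L) ≤ m := by exact_mod_cast hle
    linarith
  have h2 : Real.log 2 ≤ Real.log (1 + (m : ℝ)) := Real.log_le_log (by norm_num) (by linarith)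
  have h3 := Real.log_two_gt_d9
  have h4 : (L : ℝ) + 3 ≤ 8 * Real.log (1 + (m : ℝ)) := by nlinarith
  have h5 : (((L + 1 : ℕ) : ℝ≥0∞) + 2) = ENNReal.ofReal ((L : ℝ) + 3) := by
    rw [show (L : ℝ) + 3 = ((L + 3 : ℕ) : ℝ) by push_cast; ring, ENNReal.ofReal_natCast]
    norm_cast
  rw [h5]
  refine (ENNReal.ofReal_le_ofReal h4).trans_eq ?_
  rw [ENNReal.ofReal_mul (by norm_num)]
  simp

theorem log_le_uncondParamTilde (hp : 1 < p) (hb : IsBlockSumBasis p b) :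
    ∃ C : ℝ≥0, ∀ m : ℕ, 1 ≤ m → ENNReal.ofReal (Real.log (1 + (m : ℝ))) ≤
      C * SchauderBasis.uncondParamTilde b m := by
  have hp0 : 0 < p := by linarith
  have hs1 : 1 / p < 1 := by rw [div_lt_one] <;> linarith
  set D : ℝ := 1 / (1 - 1 / p) + 1 with hD
  have hD0 : 0 < D := by
    have : 0 < 1 / (1 - 1 / p) := one_div_pos.2 (by linarith)
    linarith
  refine ⟨(8 * p * D).toNNReal, fun m hm => ?_⟩
  obtain ⟨K, hK⟩ : ∃ K, Nat.log 2 (m + 1) = K + 1 :=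
    Nat.exists_eq_succ_of_ne_zero (Nat.log_pos (by norm_num) (by omega)).ne'
  have hlt := Nat.lt_pow_succ_log_self (b := 2) (by norm_num) (m + 1)
  have hle := Nat.pow_log_le_self 2 (x := m + 1) (by omega)
  rw [hK] at hlt hle
  set f : ℕ → 𝕜 := altSeq 𝕜 p (2 ^ K) with hf
  have hf0 : ∀ j, 2 ^ K ≤ j → f j = 0 := fun j hj => if_neg (not_lt.2 hj)
  have hnorm := truncNorm_altSeq_le (𝕜 := 𝕜) hp (2 ^ K)
  have hplace := blockSumNorm_placeBlock hp hf0
  obtain ⟨x, hx⟩ := hb.exists_coord_eq (placeBlock K f) (by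
    rw [hplace]; exact ne_top_of_le_ne_top ENNReal.ofReal_ne_top hnorm)
  have hxD : ‖x‖ ≤ D := by
    rw [← ENNReal.ofReal_le_ofReal_iff hD0.le, ofReal_norm, hb.enorm_eq, funext hx, hplace]
    exact hnorm
  set A := (Finset.range m).filter fun n => Even (n + 1 - 2 ^ K) with hA
  have hcoef : (fun i => b.coord i (SchauderBasis.coordProj b A x)) =
      placeBlock K (Set.indicator {n | Even n} f) := by
    rw [coord_coordProj, funext hx, ← indicator_placeBlock]
    ext n
    by_cases hn : n < m
    · simp [hA, hn, Set.indicator]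
    · have : placeBlock K f n = 0 := placeBlock_eq_zero (by omega)
      simp [Set.indicator, this]
  have hlow : ENNReal.ofReal (1 / p / 4 * Real.log (((2 ^ K : ℕ) : ℝ) + 1)) ≤
      ‖SchauderBasis.coordProj b A x‖ₑ := by
    rw [hb.enorm_eq, hcoef, blockSumNorm_placeBlock hp fun j hj => by
      simp [Set.indicator, hf0 j hj]]
    exact log_le_truncNorm_indicator_even hp _
  have hlog : Real.log (1 + (m : ℝ)) ≤ 2 * Real.log (((2 ^ K : ℕ) : ℝ) + 1) := by
    rw [← Nat.cast_two, ← Real.log_pow]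
    refine Real.log_le_log (by positivity) ?_
    have h1 : (1 + (m : ℝ)) ≤ 4 * 2 ^ K := by
      have : m + 1 ≤ 2 ^ (K + 1 + 1) := hlt.le
      rw [pow_succ, pow_succ] at this
      have : ((m + 1 : ℕ) : ℝ) ≤ ((2 ^ K * 2 * 2 : ℕ) : ℝ) := by exact_mod_cast this
      push_cast at this
      linarith
    push_cast
    nlinarith [sq_nonneg ((2 : ℝ) ^ K - 1)]
  set y : X := ((D⁻¹ : ℝ) : 𝕜) • x with hy
  have hy1 : ‖y‖ ≤ 1 := by
    rw [hy, norm_smul, RCLike.norm_ofReal, abs_of_pos (by positivity), inv_mul_le_iff₀ hD0,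
      mul_one]
    exact hxD
  have hysupp : ∀ n, m ≤ n → b.coord n y = 0 := fun n hn => by
    rw [hy, map_smul, hx, placeBlock_eq_zero (by omega), smul_zero]
  have hyt : ‖SchauderBasis.coordProj b A y‖ₑ ≤ SchauderBasis.uncondParamTilde b m :=
    le_iSup₂_of_le (f := fun (A : Finset ℕ) (x : X) => ⨆ (_ : ‖x‖ ≤ 1)
      (_ : ∀ n, m ≤ n → b.coord n x = 0), ‖SchauderBasis.coordProj b A x‖ₑ) A y
      (le_iSup₂_of_le hy1 hysupp le_rfl)
  have hyx : ENNReal.ofReal D * ‖SchauderBasis.coordProj b A y‖ₑ =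
      ‖SchauderBasis.coordProj b A x‖ₑ := by
    rw [hy, map_smul, ← ofReal_norm, ← ofReal_norm, norm_smul, RCLike.norm_ofReal,
      abs_of_pos (by positivity), ← ENNReal.ofReal_mul hD0.le, mul_inv_cancel_left₀ hD0.ne']
  calc ENNReal.ofReal (Real.log (1 + (m : ℝ)))
      ≤ ENNReal.ofReal (8 * p * (1 / p / 4 * Real.log (((2 ^ K : ℕ) : ℝ) + 1))) := by
        refine ENNReal.ofReal_le_ofReal (hlog.trans_eq ?_)
        field_simp
        ring
    _ = ENNReal.ofReal (8 * p) *
          ENNReal.ofReal (1 / p / 4 * Real.log (((2 ^ K : ℕ) : ℝ) + 1)) :=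
        ENNReal.ofReal_mul (by positivity)
    _ ≤ ENNReal.ofReal (8 * p) *
          (ENNReal.ofReal D * SchauderBasis.uncondParamTilde b m) := by
        gcongr
        exact hlow.trans (hyx ▸ mul_le_mul_right hyt _)
    _ = _ := by
        rw [← mul_assoc, ← ENNReal.ofReal_mul (by positivity)]
        rfl

theorem isConditional [CompleteSpace X] (hp : 1 < p) (hb : IsBlockSumBasis p b) :
    SchauderBasis.IsConditional b := by
  intro hunc
  have hsum : ∀ x, HasSum (fun n => b.coord n x • b n) x := fun x => by
    have h1 := (hunc x).hasSum
    have h2 := SchauderBasis.tendsto_proj b x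
    simp only [SchauderBasis.proj_apply] at h2
    rwa [tendsto_nhds_unique h1.tendsto_sum_nat h2] at h1
  let b' : UnconditionalSchauderBasis ℕ 𝕜 X := ⟨b.basis, b.coord, b.ortho, hsum⟩
  obtain ⟨M, hM⟩ := UnconditionalSchauderBasis.exists_norm_proj_le b'
  obtain ⟨C, hC⟩ := hb.log_le_uncondParamTilde hp
  have hle : ∀ m, SchauderBasis.uncondParam b m ≤ ENNReal.ofReal M := fun m =>
    iSup₂_le fun A _ => by
      rw [← ofReal_norm]
      exact ENNReal.ofReal_le_ofReal (hM A)
  have hM0 : 0 ≤ M := (norm_nonneg _).trans (hM ∅)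
  obtain ⟨m, hm⟩ := exists_nat_gt (Real.exp (C * M))
  have hm0 : (0 : ℝ) < m := (Real.exp_pos _).trans hm
  have h1 := (hC m (by exact_mod_cast hm0)).trans
    (mul_le_mul_right ((uncondParamTilde_le b m).trans (hle m)) _)
  rw [← ENNReal.ofReal_coe_nnreal, ← ENNReal.ofReal_mul C.coe_nonneg,
    ENNReal.ofReal_le_ofReal_iff (by positivity), Real.log_le_iff_le_exp (by positivity)] at h1
  linarith

theorem seqEquiv (hp : 1 < p) (hb : IsBlockSumBasis p b) :
    SeqEquiv (SchauderBasis.uncondParam b) (SchauderBasis.uncondParamTilde b) ∧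
      SeqEquiv (SchauderBasis.uncondParamTilde b)
        (fun m => ENNReal.ofReal (Real.log (1 + (m : ℝ)))) := by
  obtain ⟨C, hC⟩ := hb.log_le_uncondParamTilde hp
  have hmono : ∀ {c d : ℝ≥0} {x : ℝ≥0∞}, c ≤ d → (c : ℝ≥0∞) * x ≤ d * x := fun h =>
    mul_le_mul_left (by exact_mod_cast h) _
  refine ⟨⟨max (8 * C) 1, fun m hm => ?_, fun m _ => ?_⟩, ⟨max 8 C, fun m hm => ?_, fun m hm => ?_⟩⟩
  · refine ((hb.uncondParam_le_log hp hm).trans (mul_le_mul_right (hC m hm) _)).trans ?_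
    rw [← mul_assoc, ← ENNReal.coe_mul]
    exact hmono (le_max_left _ _)
  · refine (uncondParamTilde_le b m).trans (le_trans ?_ (hmono (le_max_right _ _)))
    simp
  · exact ((uncondParamTilde_le b m).trans (hb.uncondParam_le_log hp hm)).trans
      (hmono (le_max_left _ _))
  · exact (hC m hm).trans (hmono (le_max_right _ _))

/-- The bound of a functional on tails improves by a constant factor on further tails. -/
theorem exists_tail_bound_mul (hp : 1 < p) (hb : IsBlockSumBasis p b) (g : StrongDual 𝕜 X) {c : ℝ}
    (hc : 0 ≤ c) (h : ∃ M, ∀ x, (∀ n < M, b.coord n x = 0) → ‖g x‖ ≤ c * ‖x‖) :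
    ∃ M, ∀ x, (∀ n < M, b.coord n x = 0) → ‖g x‖ ≤ (2 : ℝ) ^ (1 / p - 1) * c * ‖x‖ := by
  have hp0 : 0 < p := by linarith
  by_contra! hcon
  have hc' : 0 ≤ (2 : ℝ) ^ (1 / p - 1) * c := by positivity
  obtain ⟨M, hM⟩ := h
  obtain ⟨x, hx, hgx⟩ := hcon M
  obtain ⟨u, N, r, huM, huN, hu1, hr, hgu⟩ := exists_unit_vector b g hc' hx hgx
  set K := max M N with hK
  have hKN : K ≤ 2 ^ K - 1 := by have := Nat.lt_two_pow_self (n := K); omega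
  obtain ⟨x', hx', hgx'⟩ := hcon (2 ^ K - 1)
  obtain ⟨v, N', r', hvM, _, hv1, hr', hgv⟩ := exists_unit_vector b g hc' hx' hgx'
  have hadd : ‖u + v‖ₑ ^ p = 2 := by
    have hsum : (fun n => b.coord n (u + v)) = (fun n => b.coord n u) + fun n => b.coord n v := by
      ext n; simp
    rw [hb.enorm_eq, hsum, blockSumNorm_add_rpow hp K (fun n hn => huN n (by omega)) hvM,
      ← hb.enorm_eq, ← hb.enorm_eq, ← ofReal_norm, ← ofReal_norm, hu1, hv1]
    norm_num
  have hnorm : ‖u + v‖ = (2 : ℝ) ^ (1 / p) := by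
    have h2 : ‖u + v‖ ^ p = 2 := by
      have := congrArg ENNReal.toReal hadd
      rwa [← ENNReal.toReal_rpow, toReal_enorm, ENNReal.toReal_ofNat] at this
    rw [← h2, ← Real.rpow_mul (norm_nonneg _), mul_one_div_cancel hp0.ne', Real.rpow_one]
  have hle := hM (u + v) fun n hn => by
    rw [map_add, huM n hn, hvM n (by omega), add_zero]
  rw [map_add, hgu, hgv, ← RCLike.ofReal_add, RCLike.norm_ofReal, hnorm] at hle
  have hpow : (2 : ℝ) ^ (1 / p) = 2 * (2 : ℝ) ^ (1 / p - 1) := by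
    rw [Real.rpow_sub_one (by norm_num)]; ring
  rw [hpow] at hle
  have := le_abs_self (r + r')
  linarith

/-- The basis is shrinking: functionals are small on tails. -/
theorem exists_tail_bound (hp : 1 < p) (hb : IsBlockSumBasis p b) (g : StrongDual 𝕜 X) {ε : ℝ}
    (hε : 0 < ε) : ∃ M, ∀ x, (∀ n < M, b.coord n x = 0) → ‖g x‖ ≤ ε * ‖x‖ := by
  have hs1 : 1 / p < 1 := by rw [div_lt_one] <;> linarith
  have hiter : ∀ i : ℕ, ∃ M, ∀ x, (∀ n < M, b.coord n x = 0) →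
      ‖g x‖ ≤ ((2 : ℝ) ^ (1 / p - 1)) ^ i * ‖g‖ * ‖x‖ := by
    intro i
    induction i with
    | zero => exact ⟨0, fun x _ => by simpa using g.le_opNorm x⟩
    | succ i ih =>
      have := hb.exists_tail_bound_mul hp g (by positivity) ih
      rwa [← mul_assoc, ← pow_succ'] at this
  have hlt : (2 : ℝ) ^ (1 / p - 1) < 1 :=
    Real.rpow_lt_one_of_one_lt_of_neg (by norm_num) (by linarith)
  have htend := (tendsto_pow_atTop_nhds_zero_of_lt_one (by positivity) hlt).mul_const ‖g‖
  rw [zero_mul] at htend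
  obtain ⟨i, hi⟩ := (htend.eventually (gt_mem_nhds hε)).exists
  obtain ⟨M, hM⟩ := hiter i
  exact ⟨M, fun x hx => (hM x hx).trans (by gcongr)⟩

theorem isReflexiveSpace (hp : 1 < p) (hb : IsBlockSumBasis p b) : IsReflexiveSpace 𝕜 X := by
  intro Φ
  set a : ℕ → 𝕜 := fun n => Φ (b.coord n) with ha
  have hcomp : ∀ (g : StrongDual 𝕜 X) (N : ℕ),
      Φ (g.comp (SchauderBasis.coordProj b (Finset.range N))) =
        g (∑ n ∈ Finset.range N, a n • b n) := by
    intro g N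
    have : g.comp (SchauderBasis.coordProj b (Finset.range N)) =
        ∑ n ∈ Finset.range N, g (b n) • b.coord n := by
      ext x
      simp [SchauderBasis.coordProj, mul_comm]
    rw [this, map_sum, map_sum]
    simp [ha, mul_comm]
  have hbound : ∀ N, blockSumNorm p ((Set.Iio N).indicator a) ≤ ‖Φ‖ₑ := by
    intro N
    have hcoord := coord_sum b (Finset.range N) a
    rw [Finset.coe_range] at hcoord
    rw [← hcoord, ← hb.enorm_eq]
    refine enorm_le_iff_norm_le.2 ?_
    obtain ⟨g, hg1, hg⟩ := exists_dual_vector'' 𝕜 (∑ n ∈ Finset.range N, a n • b n)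
    have hgN : ‖g.comp (SchauderBasis.coordProj b (Finset.range N))‖ ≤ 1 :=
      ContinuousLinearMap.opNorm_le_bound _ zero_le_one fun x =>
        (g.le_of_opNorm_le_of_le hg1 (hb.norm_coordProj_range_apply_le hp N x))
    have h := Φ.le_opNorm_of_le hgN
    rw [hcomp, hg, RCLike.norm_ofReal, abs_of_nonneg (norm_nonneg _), mul_one] at h
    exact h
  obtain ⟨x, hx⟩ := hb.exists_coord_eq a (ne_top_of_le_ne_top enorm_ne_top
    (blockSumNorm_le_of_forall_indicator_Iio_le hp hbound))
  refine ⟨x, ContinuousLinearMap.ext fun g => ?_⟩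
  rw [NormedSpace.dual_def]
  have hlim : Filter.Tendsto (fun N => g (∑ n ∈ Finset.range N, a n • b n)) Filter.atTop
      (nhds (g x)) := by
    have := (g.continuous.tendsto x).comp (SchauderBasis.tendsto_proj b x)
    simpa only [Function.comp_def, SchauderBasis.proj_apply, hx] using this
  refine tendsto_nhds_unique hlim ?_
  simp only [← hcomp]
  refine (Φ.continuous.tendsto g).comp ?_
  rw [Metric.tendsto_atTop]
  intro ε hε
  obtain ⟨M, hM⟩ := hb.exists_tail_bound hp g (half_pos hε)
  refine ⟨M, fun N hN => ?_⟩
  rw [dist_comm, dist_eq_norm]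
  refine lt_of_le_of_lt (ContinuousLinearMap.opNorm_le_bound _ (half_pos hε).le fun y => ?_)
    (half_lt_self hε)
  have hsub := coord_sub_coordProj b (Finset.range N) y
  rw [Finset.coe_range, Set.compl_Iio] at hsub
  have h1 := hM (y - SchauderBasis.coordProj b (Finset.range N) y) fun n hn => by
    rw [congrFun hsub n, Set.indicator_of_notMem (by simp; omega)]
  have h2 : ‖y - SchauderBasis.coordProj b (Finset.range N) y‖ ≤ ‖y‖ := hb.norm_le_norm (by
    rw [hsub]; exact blockSumNorm_indicator_Ici_le hp N _)
  rw [_root_.sub_apply, ContinuousLinearMap.comp_apply, ← map_sub]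
  exact h1.trans (by gcongr)

end IsBlockSumBasis

end BlockSumBasis

theorem mainTheorem5 (𝕜 : Type u) [RCLike 𝕜] (p : ℝ) (hp : 1 < p) :
    ∃ (X : Type u) (_ : NormedAddCommGroup X) (_ : NormedSpace 𝕜 X) (_ : CompleteSpace X)
      (b : SchauderBasis 𝕜 X),
      IsReflexiveSpace 𝕜 X ∧
      SchauderBasis.IsConditional b ∧
      SchauderBasis.IsBimonotone b ∧
      SchauderBasis.IsIsometricallyBidemocratic b ∧
      SchauderBasis.IsOneSuppressionQuasiGreedy b ∧
      SeqEquiv (SchauderBasis.uncondParam b) (SchauderBasis.uncondParamTilde b) ∧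
      SeqEquiv (SchauderBasis.uncondParamTilde b)
        (fun m => ENNReal.ofReal (Real.log (1 + (m : ℝ)))) ∧
      (∀ x : X, ‖x‖ₑ = blockSumNorm p (fun n => b.coord n x)) := by
  obtain ⟨X, _, _, _, T, hT, hsurj⟩ := exists_blockSum_space 𝕜 p hp
  obtain ⟨b, hbT⟩ := exists_blockSum_basis hp T hT hsurj
  have hb : IsBlockSumBasis p b := by
    refine ⟨fun x => ?_, fun a ha => ?_⟩
    · rw [hT]
      simp only [hbT]
    · obtain ⟨x, rfl⟩ := hsurj a ha
      exact ⟨x, fun n => hbT n x⟩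
  exact ⟨X, _, _, inferInstance, b, hb.isReflexiveSpace hp, hb.isConditional hp,
    hb.isBimonotone hp, hb.isIsometricallyBidemocratic hp, hb.isOneSuppressionQuasiGreedy hp,
    (hb.seqEquiv hp).1, (hb.seqEquiv hp).2, hb.enorm_eq⟩
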